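/- For $N\ge 1$ let $\mathbb{GT}_N$ be the set of signatures of length $N$, i.e. of $N$-tuples of integers $\lambda=(\lambda_1\ge\dots\ge\lambda_N)$. Write $\lambda\prec\mu$ for $\lambda\in\mathbb{GT}_N$, $\mu\in\mathbb{GT}_{N+1}$ if $\mu_1\ge\lambda_1\ge\mu_2\ge\dots\ge\lambda_N\ge\mu_{N+1}$. Let $\mathcal T$ be the space of infinite paths $\tau=(\tau(1)\prec\tau(2)\prec\dots)$, $\tau(N)\in\mathbb{GT}_N$, with the Borel $\sigma$-algebra of the topology whose base consists of the cylindrical sets $C_{(\tau(1),\dots,\tau(N))}=\{t\in\mathcal T: t(1)=\tau(1),\dots,t(N)=\tau(N)\}$. For a signature $\lambda\in\mathbb{GT}_N$ let $\lambda^+$ be the Young diagram whose row lengths are the positive coordinates of $\lambda$, and let $$\operatorname{Dim}_N(\lambda)=\prod_{1\le i<j\le N}\frac{\lambda_i-\lambda_j+j-i}{j-i}$$ be the dimension of the irreducible representation of $U(N)$ with highest weight $\lambda$. Let $z,w\in\mathbb C$ with $\Re(z+w)>-\tfrac12$, and let $$M_N^{z,w}(\lambda)=\frac{1}{S_N(z,w)}\prod_{i=1}^N\left|\frac{1}{\Gamma(z-\lambda_i+i)\,\Gamma(w+N+1+\lambda_i-i)}\right|^2\operatorname{Dim}_N(\lambda)^2,\qquad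 \lambda\in\mathbb{GT}_N,$$ where $S_N(z,w)$ is the normalization constant making $M_N^{z,w}$ a probability distribution on $\mathbb{GT}_N$. The $(z,w)$-measure is the Borel probability measure $\rho_{z,w}$ on $\mathcal T$ with $$\rho_{z,w}\bigl(C_{(\tau(1),\dots,\tau(N))}\bigr)=\frac{M_N^{z,w}(\tau(N))}{\operatorname{Dim}_N(\tau(N))}$$ for every finite path $(\tau(1),\dots,\tau(N))$. **Theorem 12.** There exists a positive constant $c(z,w)$, depending only on $z$ and $w$, such that for $\rho_{z,w}$-almost every path $\tau\in\mathcal T$ $$\limsup_{N\to\infty}\frac{\tilde s_N(\tau)}{\log N}\le c(z,w),$$ where $\tilde s_N(\tau)$ is the length of the main diagonal of the Young diagram $\tau(N)^+$ (the number of its boxes $(i,j)$ with $i=j$). -/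

import Mathlib

/-- A signature of length `N` (a vertex at level `N` of the Gelfand-Tsetlin graph): a weakly
decreasing `N`-tuple of integers `λ₁ ≥ ⋯ ≥ λ_N`. The coordinate `λ_{i+1}` is `row i` for
`i : Fin N`, since indices in `Fin N` start from `0`. -/
@[ext]
structure GTSignature (N : ℕ) where
  row : Fin N → ℤ
  antitone_row : Antitone row

namespace GTSignature

/-- The edges of the Gelfand-Tsetlin graph: `l ≺ m` if and only if
`m₁ ≥ l₁ ≥ m₂ ≥ ⋯ ≥ l_N ≥ m_{N+1}`. -/
def Interlaces {N : ℕ} (l : GTSignature N) (m : GTSignature (N + 1)) : Prop :=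
  ∀ i : Fin N, l.row i ≤ m.row i.castSucc ∧ m.row i.succ ≤ l.row i

/-- `Dim_N(λ)`, the dimension of the irreducible representation of the unitary group `U(N)` with
highest weight `λ`, given by Weyl's dimension formula
`∏_{1 ≤ i < j ≤ N} (λ_i - λ_j + j - i) / (j - i)`. -/
noncomputable def dim {N : ℕ} (l : GTSignature N) : ℝ :=
  ∏ i : Fin N, ∏ j ∈ Finset.Ioi i,
    ((l.row i : ℝ) - (l.row j : ℝ) + ((j : ℕ) : ℝ) - ((i : ℕ) : ℝ)) /
      (((j : ℕ) : ℝ) - ((i : ℕ) : ℝ))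

/-- The cells of the positive Young diagram `λ⁺`, whose row lengths are the positive coordinates
of `λ`. Rows and columns are numbered from `0`. -/
def positiveCells {N : ℕ} (l : GTSignature N) : Finset (ℕ × ℕ) :=
  (Finset.univ : Finset (Fin N)).biUnion fun i =>
    (Finset.range (l.row i).toNat).image fun j => ((i : ℕ), j)

theorem mem_positiveCells {N : ℕ} (l : GTSignature N) (i j : ℕ) :
    (i, j) ∈ l.positiveCells ↔ ∃ h : i < N, (j : ℤ) < l.row ⟨i, h⟩ := by
  simp only [positiveCells, Finset.mem_biUnion, Finset.mem_univ, true_and, Finset.mem_image,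
    Finset.mem_range, Prod.mk.injEq]
  constructor
  · rintro ⟨a, b, hb, rfl, rfl⟩
    exact ⟨a.2, by simpa using (Int.lt_toNat.mp hb)⟩
  · rintro ⟨h, hj⟩
    exact ⟨⟨i, h⟩, j, Int.lt_toNat.mpr hj, rfl, rfl⟩

/-- The positive Young diagram `λ⁺` of a signature `λ`. -/
def positiveDiagram {N : ℕ} (l : GTSignature N) : YoungDiagram where
  cells := l.positiveCells
  isLowerSet := by
    rintro ⟨i, j⟩ ⟨i', j'⟩ hle hmem
    obtain ⟨hi, hj⟩ := Prod.mk_le_mk.mp hle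
    rw [Finset.mem_coe, mem_positiveCells] at hmem ⊢
    obtain ⟨h, hlt⟩ := hmem
    refine ⟨lt_of_le_of_lt hi h, ?_⟩
    have h1 : l.row ⟨i, h⟩ ≤ l.row ⟨i', lt_of_le_of_lt hi h⟩ :=
      l.antitone_row (by simpa using hi)
    have h2 : (j' : ℤ) ≤ (j : ℤ) := by exact_mod_cast hj
    linarith

/-- The unnormalized weight of a signature `λ` at level `N`:
`∏_{i=1}^N |1 / (Γ(z - λ_i + i) Γ(w + N + 1 + λ_i - i))|² ⬝ Dim_N(λ)²`.
(The convention `Γ = 0`, `1 / Γ = 0` at the poles of `Γ` agrees with the entire function `1 / Γ`.) -/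
noncomputable def zwWeight (z w : ℂ) {N : ℕ} (l : GTSignature N) : ℝ :=
  (∏ i : Fin N,
    ‖1 / (Complex.Gamma (z - (l.row i : ℂ) + (((i : ℕ) : ℂ) + 1)) *
      Complex.Gamma (w + (N : ℂ) + 1 + (l.row i : ℂ) - (((i : ℕ) : ℂ) + 1)))‖ ^ 2) * l.dim ^ 2

end GTSignature

/-- The normalization constant `S_N(z, w)`: the sum of the weights of all signatures at level
`N`. -/
noncomputable def zwNormalization (z w : ℂ) (N : ℕ) : ℝ :=
  ∑' l : GTSignature N, l.zwWeight z w

/-- The distribution `M_N^{z,w}` at level `N`. -/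
noncomputable def zwLevel (z w : ℂ) {N : ℕ} (l : GTSignature N) : ℝ :=
  (zwNormalization z w N)⁻¹ * l.zwWeight z w

/-- The length of the main diagonal of a Young diagram: the number of its boxes of content `0`. -/
def YoungDiagram.diagonalLength (Y : YoungDiagram) : ℕ :=
  (Y.cells.filter fun c => c.1 = c.2).card

/-- Infinite paths in the Gelfand-Tsetlin graph: `sig N` is the vertex at level `N`. The level `0`,
which has the empty signature as its only vertex, is included for convenience; it carries no
information. -/
structure GTPath where
  sig : (N : ℕ) → GTSignature N
  interlaces : ∀ N, (sig N).Interlaces (sig (N + 1))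

namespace GTPath

/-- The cylindrical set of the finite path `(τ(1), …, τ(N))`. Every finite path in the
Gelfand-Tsetlin graph is an initial segment of an infinite one, so that all cylindrical sets have
this form. -/
def cylinder (τ : GTPath) (N : ℕ) : Set GTPath :=
  {t | ∀ n, 1 ≤ n → n ≤ N → t.sig n = τ.sig n}

/-- The topology on the set of infinite paths that has the cylindrical sets as a base. -/
instance : TopologicalSpace GTPath :=
  TopologicalSpace.generateFrom {C | ∃ (τ : GTPath) (N : ℕ), 1 ≤ N ∧ C = cylinder τ N}

instance : MeasurableSpace GTPath := borel GTPath

instance : BorelSpace GTPath := ⟨rfl⟩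

/-- The length of the main diagonal of the positive Young diagram of `τ(N)`. -/
def diagonal (τ : GTPath) (N : ℕ) : ℕ :=
  (τ.sig N).positiveDiagram.diagonalLength

end GTPath

/-- `ρ` is the `(z, w)`-measure: the Borel probability measure on the space of infinite paths with
`ρ(C_τ) = M_N^{z,w}(τ(N)) / Dim_N(τ(N))` for every finite path `τ = (τ(1), …, τ(N))`. -/
structure IsZWMeasure (z w : ℂ) (ρ : MeasureTheory.Measure GTPath) : Prop where
  isProbabilityMeasure : MeasureTheory.IsProbabilityMeasure ρ
  measure_cylinder : ∀ (τ : GTPath) (N : ℕ), 1 ≤ N →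
    ρ (τ.cylinder N) = ENNReal.ofReal (zwLevel z w (τ.sig N) / (τ.sig N).dim)

/-! In the coordinates `x_i = λ_i - i + k` (rows numbered from 1) the level distribution is an
orthogonal polynomial ensemble on `ℤ`: a squared Vandermonde determinant times a product of
one-particle weights `φ(x_i)²`. Up to the bounded error `|k|`, the diagonal length is the number of
particles in `W = {x ≥ 0}`. It suffices to bound the exponential moment of this number by a power of
`N`; Markov's inequality and Borel–Cantelli do the rest.

By Andréief's identity, `E 2^#(particles in W)` is a quotient of Gram determinants, the numerator
having its mass doubled on `W`. In an orthonormal basis of the span of the functions `φ(x) x^j` the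
quotient is `det(1 + X)` with `X ≥ 0`, hence at most `exp(tr X)`, where `tr X` is the mass that the
basis puts on `W`. This mass is `O(log N)` if, on a subspace of codimension `O(log N)`, values on
`W` are recovered from values elsewhere by a kernel with squared Hilbert–Schmidt norm `O(log N)`
(`Matrix.det_gram_doubled_le`).

The kernel comes from Lagrange interpolation at `-1, …, -M` with `M = N - 1`. Gamma asymptotics
bound it by a multiple of `((x+1)/(a+1))^s / (x+a+1)`, `0 ≤ s < 1`. For `s ≥ 1/2` this is not square
summable in `x`. Requiring that the partial sums of the interpolation data vanish at dyadic cutoffs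
costs `O(log M)` linear conditions and lets one subtract the leading term in `x`. What remains is
bounded by a multiple of `1/(x+a+1)`, whose squared norm grows like a harmonic sum
(`exists_regularized_interpolation`).

To pass from cylinders to the law of a single level, the branching rule for dimensions is used; only
an upper bound for that law is needed. -/

/-! ### Gram determinants and the exponential moment of a particle count. -/

theorem Matrix.sum_det_rows {R : Type*} [CommRing R] {N : ℕ} {X : Type*} [Fintype X]
    (g : Fin N → X → Fin N → R) :
    ∑ x : Fin N → X, (Matrix.of fun i j => g i (x i) j).det =
      (Matrix.of fun i j => ∑ y, g i y j).det := by
  classical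
  have h := MultilinearMap.map_sum (Matrix.detRowAlternating (n := Fin N) (R := R)).toMultilinearMap g
  have h2 : (fun i => ∑ y, g i y) = Matrix.of fun i j => ∑ y, g i y j := by
    ext i j; simp
  rw [h2] at h
  exact h.symm

/-- Andréief's identity for a discrete measure with weights `u`. -/
theorem Matrix.sum_prod_mul_det_sq {N : ℕ} {X : Type*} [Fintype X] (u : X → ℝ)
    (v : Fin N → X → ℝ) :
    ∑ x : Fin N → X, (∏ i, u (x i)) * (Matrix.of fun i j => v j (x i)).det ^ 2 =
      (N.factorial : ℝ) * (Matrix.of fun j k => ∑ x, u x * v j x * v k x).det := by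
  -- Only one of the two determinants is expanded; its monomials are absorbed into the rows of the
  -- other, so that row `i` depends on `x i` alone.
  have key : ∀ x : Fin N → X, (∏ i, u (x i)) * (Matrix.of fun i j => v j (x i)).det ^ 2 =
      ∑ τ : Equiv.Perm (Fin N), ((Equiv.Perm.sign τ : ℤ) : ℝ) *
        (Matrix.of fun i j => u (x i) * v (τ i) (x i) * v j (x i)).det := by
    intro x
    have h1 : (Matrix.of fun i j => v j (x i)).det =
        ∑ τ : Equiv.Perm (Fin N), ((Equiv.Perm.sign τ : ℤ) : ℝ) * ∏ i, v (τ i) (x i) := by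
      rw [← Matrix.det_transpose, Matrix.det_apply']
      rfl
    rw [sq]
    nth_rewrite 1 [h1]
    rw [Finset.sum_mul, Finset.mul_sum]
    refine Finset.sum_congr rfl fun τ _ => ?_
    have h2 := Matrix.det_mul_column (fun i => u (x i) * v (τ i) (x i))
      (Matrix.of fun i j => v j (x i))
    simp only [Matrix.of_apply] at h2
    rw [h2, Finset.prod_mul_distrib]
    ring
  simp_rw [key]
  rw [Finset.sum_comm]
  have h3 : ∀ τ : Equiv.Perm (Fin N), ∑ x : Fin N → X, ((Equiv.Perm.sign τ : ℤ) : ℝ) *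
        (Matrix.of fun i j => u (x i) * v (τ i) (x i) * v j (x i)).det =
      (Matrix.of fun j k => ∑ x, u x * v j x * v k x).det := by
    intro τ
    rw [← Finset.mul_sum, Matrix.sum_det_rows (fun i y j => u y * v (τ i) y * v j y)]
    have h4 := Matrix.det_permute τ (Matrix.of fun j k => ∑ x, u x * v j x * v k x)
    have h5 : (Matrix.of fun j k => ∑ x, u x * v j x * v k x).submatrix τ id =
        Matrix.of fun i j => ∑ y, u y * v (τ i) y * v j y := by
      ext i j; rfl
    rw [← h5, h4, ← mul_assoc]
    have h6 : (((Equiv.Perm.sign τ : ℤˣ) : ℤ) : ℝ) * (((Equiv.Perm.sign τ : ℤˣ) : ℤ) : ℝ) = 1 := by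
      rw [← Int.cast_mul, ← Units.val_mul, Int.units_mul_self]; simp
    rw [h6, one_mul]
  simp_rw [h3]
  simp [Fintype.card_perm]

/-- Apply `t ≤ exp (t - 1)` to each eigenvalue and multiply. -/
theorem Matrix.PosSemidef.det_le_exp_trace_sub {N : ℕ} {H : Matrix (Fin N) (Fin N) ℝ}
    (hH : H.PosSemidef) : H.det ≤ Real.exp (H.trace - N) := by
  rw [hH.isHermitian.det_eq_prod_eigenvalues, hH.isHermitian.trace_eq_sum_eigenvalues]
  have : ∑ i, ((hH.isHermitian.eigenvalues i : ℝ) : ℝ) - N =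
      ∑ i, (hH.isHermitian.eigenvalues i - 1) := by simp
  simp only [RCLike.ofReal_real_eq_id, id]
  rw [this, Real.exp_sum]
  refine Finset.prod_le_prod (fun i _ => hH.eigenvalues_nonneg i) fun i _ => ?_
  have := Real.add_one_le_exp (hH.isHermitian.eigenvalues i - 1)
  linarith

/-- In an `N`-dimensional inner product space, a subspace of codimension at most `r` leaves residual
mass at most `r` of an orthonormal basis. -/
theorem OrthonormalBasis.sum_norm_sub_starProjection_le {F : Type*} [NormedAddCommGroup F]
    [InnerProductSpace ℝ F] [FiniteDimensional ℝ F] {N r : ℕ} (b : OrthonormalBasis (Fin N) ℝ F)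
    (K : Submodule ℝ F) (hK : N ≤ Module.finrank ℝ K + r) :
    ∑ k, ‖b k - K.starProjection (b k)‖ ^ 2 ≤ r := by
  have h1 : ∀ k, ‖b k - K.starProjection (b k)‖ ^ 2 = 1 - ‖K.starProjection (b k)‖ ^ 2 := by
    intro k
    have h := Submodule.norm_sq_eq_add_norm_sq_starProjection (b k) K
    rw [b.orthonormal.1 k, Submodule.starProjection_orthogonal_val] at h
    linarith
  have h2 : ∑ k, ‖K.starProjection (b k)‖ ^ 2 = Module.finrank ℝ K := by
    have c := stdOrthonormalBasis ℝ K
    have h3 : ∀ k, ‖K.starProjection (b k)‖ ^ 2 =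
        ∑ l, ‖inner ℝ ((c l : K) : F) (b k)‖ ^ 2 := by
      intro k
      have := c.sum_sq_norm_inner_right (K.orthogonalProjectionOnto (b k))
      rw [Submodule.starProjection_apply, ← Submodule.coe_norm, ← this]
      refine Finset.sum_congr rfl fun l _ => ?_
      rw [← Submodule.inner_orthogonalProjectionOnto_eq_of_mem_left]
    simp_rw [h3]
    rw [Finset.sum_comm]
    simp_rw [b.sum_sq_norm_inner_left]
    have h4 : ∀ l, ‖((c l : K) : F)‖ = 1 := fun l => by
      rw [Submodule.norm_coe]; exact c.orthonormal.1 l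
    simp [h4]
  rw [Finset.sum_congr rfl fun k _ => h1 k, Finset.sum_sub_distrib, h2]
  have : (N : ℝ) ≤ Module.finrank ℝ K + r := by exact_mod_cast hK
  simp
  linarith

/-- Split each basis vector into its projection to `K` and a residual. The residuals have total mass
at most `r`; the projections are evaluated through `C`, and Parseval bounds their contribution by
the squared Hilbert–Schmidt norm. The factor 2 is from `(p + q)² ≤ 2p² + 2q²`. -/
theorem OrthonormalBasis.sum_sq_eval_le {X : Type*} [Fintype X] [DecidableEq X] {N r : ℕ}
    (V : Submodule ℝ (EuclideanSpace ℝ X)) (b : OrthonormalBasis (Fin N) ℝ V)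
    (K : Submodule ℝ V) (hK : N ≤ Module.finrank ℝ K + r) (W : Finset X)
    (C : X → EuclideanSpace ℝ X)
    (hC : ∀ y ∈ K, ∀ x ∈ W, (y : EuclideanSpace ℝ X) x = inner ℝ (C x) (y : EuclideanSpace ℝ X)) :
    ∑ x ∈ W, ∑ k, ((b k : V) : EuclideanSpace ℝ X) x ^ 2 ≤ 2 * (r + ∑ x ∈ W, ‖C x‖ ^ 2) := by
  set R : Fin N → V := fun k => b k - K.starProjection (b k) with hR
  have h1 : ∀ x ∈ W, ∑ k, ((b k : V) : EuclideanSpace ℝ X) x ^ 2 ≤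
      2 * ‖C x‖ ^ 2 + 2 * ∑ k, ((R k : V) : EuclideanSpace ℝ X) x ^ 2 := by
    intro x hx
    -- Self-adjointness moves both projections onto `C x`, leaving coefficients of one fixed vector
    -- in the basis `b`.
    have h2 : ∀ k, ((b k : V) : EuclideanSpace ℝ X) x =
        inner ℝ (K.starProjection (V.orthogonalProjectionOnto (C x))) (b k) +
          ((R k : V) : EuclideanSpace ℝ X) x := by
      intro k
      have h3 := hC (K.starProjection (b k)) (K.starProjection_apply_mem _) x hx
      rw [Submodule.inner_starProjection_left_eq_right,
        Submodule.inner_orthogonalProjectionOnto_eq_of_mem_right, ← h3]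
      simp [hR]
    have h4 : ∑ k, ‖inner ℝ (K.starProjection (V.orthogonalProjectionOnto (C x))) (b k)‖ ^ 2 ≤
        ‖C x‖ ^ 2 := by
      rw [b.sum_sq_norm_inner_left]
      have h5 := K.norm_starProjection_apply_le (V.orthogonalProjectionOnto (C x))
      have h6 := V.norm_orthogonalProjectionOnto_apply_le (C x)
      gcongr
      exact h5.trans h6
    calc ∑ k, ((b k : V) : EuclideanSpace ℝ X) x ^ 2
        ≤ ∑ k, (2 * ‖inner ℝ (K.starProjection (V.orthogonalProjectionOnto (C x))) (b k)‖ ^ 2 +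
            2 * ((R k : V) : EuclideanSpace ℝ X) x ^ 2) := by
          refine Finset.sum_le_sum fun k _ => ?_
          rw [h2 k, Real.norm_eq_abs, sq_abs]
          nlinarith [sq_nonneg (inner ℝ (K.starProjection (V.orthogonalProjectionOnto (C x))) (b k)
            - ((R k : V) : EuclideanSpace ℝ X) x)]
      _ ≤ _ := by
          rw [Finset.sum_add_distrib, ← Finset.mul_sum, ← Finset.mul_sum]
          linarith
  have h7 : ∑ x ∈ W, ∑ k, ((R k : V) : EuclideanSpace ℝ X) x ^ 2 ≤ r := by
    refine le_trans ?_ (b.sum_norm_sub_starProjection_le K hK)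
    rw [Finset.sum_comm]
    refine Finset.sum_le_sum fun k _ => ?_
    rw [Submodule.coe_norm, EuclideanSpace.norm_sq_eq]
    simp only [Real.norm_eq_abs, sq_abs]
    exact Finset.sum_le_sum_of_subset_of_nonneg (Finset.subset_univ _) fun _ _ _ => sq_nonneg _
  calc _ ≤ ∑ x ∈ W, (2 * ‖C x‖ ^ 2 + 2 * ∑ k, ((R k : V) : EuclideanSpace ℝ X) x ^ 2) :=
        Finset.sum_le_sum h1
    _ ≤ _ := by
      rw [Finset.sum_add_distrib, ← Finset.mul_sum, ← Finset.mul_sum]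
      linarith

theorem Matrix.of_gram_eq {X : Type*} [Fintype X] [DecidableEq X] {N : ℕ} (u : X → ℝ)
    (v : Fin N → X → ℝ) : (Matrix.of fun j k => ∑ x, u x * v j x * v k x) =
      (Matrix.of fun x j => v j x).transpose * Matrix.diagonal u * Matrix.of fun x j => v j x := by
  ext j k
  rw [Matrix.mul_apply]
  simp [Matrix.mul_diagonal, mul_comm]

/-- Doubling the mass on `W` increases a Gram determinant by a bounded factor, if the functions in a
subspace of codimension `r` are recovered on `W` by an integral operator with kernel `C`. -/
theorem Matrix.det_gram_doubled_le {X : Type*} [Fintype X] [DecidableEq X] {N r : ℕ}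
    (v : Fin N → X → ℝ) (W : Finset X) (l : (Fin N → ℝ) →ₗ[ℝ] (Fin r → ℝ)) (C : X → X → ℝ)
    (hC : ∀ c, l c = 0 → ∀ x ∈ W, ∑ j, c j * v j x = ∑ y, C x y * ∑ j, c j * v j y) :
    (Matrix.of fun j k => ∑ x, (if x ∈ W then 2 else 1) * v j x * v k x).det ≤
      Real.exp (2 * (r + ∑ x ∈ W, ∑ y, C x y ^ 2)) *
        (Matrix.of fun j k => ∑ x, 1 * v j x * v k x).det := by
  set e : Fin N → EuclideanSpace ℝ X := fun j => WithLp.toLp 2 (v j) with he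
  by_cases hli : LinearIndependent ℝ e
  · set V := Submodule.span ℝ (Set.range e)
    have hfin : Module.finrank ℝ V = N := by
      rw [finrank_span_eq_card hli, Fintype.card_fin]
    let B := Module.Basis.span hli
    let b : OrthonormalBasis (Fin N) ℝ V :=
      (stdOrthonormalBasis ℝ V).reindex (finCongr hfin)
    let L : V →ₗ[ℝ] (Fin r → ℝ) := l ∘ₗ (B.equivFun : V →ₗ[ℝ] (Fin N → ℝ))
    have hK : N ≤ Module.finrank ℝ L.ker + r := by
      have h1 := L.finrank_range_add_finrank_ker
      have h2 : Module.finrank ℝ L.range ≤ r := by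
        have := Submodule.finrank_le L.range
        simpa using this
      omega
    have hcomb : ∀ y : V, ∀ x, (y : EuclideanSpace ℝ X) x = ∑ j, B.equivFun y j * v j x := by
      intro y x
      conv_lhs => rw [← B.sum_equivFun y]
      have : ∀ j, ((B j : V) : EuclideanSpace ℝ X) x = v j x := fun j => by
        simp only [B, Module.Basis.span_apply hli j, he]
      rw [AddSubmonoidClass.coe_finsetSum, WithLp.ofLp_sum, Finset.sum_apply]
      refine Finset.sum_congr rfl fun j _ => ?_
      rw [Submodule.coe_smul, PiLp.smul_apply, this, smul_eq_mul]
    have hmain := b.sum_sq_eval_le V L.ker hK W (fun x => WithLp.toLp 2 (C x)) (by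
      intro y hy x hx
      have hy' : l (B.equivFun y) = 0 := hy
      rw [hcomb, hC _ hy' x hx, PiLp.inner_apply]
      refine Finset.sum_congr rfl fun z _ => ?_
      rw [hcomb y z]
      simp [mul_comm])
    simp only [EuclideanSpace.norm_sq_eq, Real.norm_eq_abs, sq_abs] at hmain
    -- change of basis
    let A : Matrix (Fin N) (Fin N) ℝ := Matrix.of fun k j => b.toBasis.repr (B j) k
    have hv : ∀ j x, v j x = ∑ k, A k j * ((b k : V) : EuclideanSpace ℝ X) x := by
      intro j x
      have h1 : ((B j : V) : EuclideanSpace ℝ X) x = v j x := by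
        have := Module.Basis.span_apply hli j
        change ((Module.Basis.span hli j : V) : EuclideanSpace ℝ X) x = v j x
        rw [this]
      rw [← h1]
      conv_lhs => rw [← b.toBasis.sum_repr (B j)]
      simp [A]
    set Q : Matrix X (Fin N) ℝ := Matrix.of fun x k => ((b k : V) : EuclideanSpace ℝ X) x
    have hvQ : (Matrix.of fun x j => v j x) = Q * A := by
      ext x j
      simp only [Matrix.of_apply, Matrix.mul_apply, hv j x, Q]
      exact Finset.sum_congr rfl fun _ _ => mul_comm _ _
    have hG : ∀ u : X → ℝ, (Matrix.of fun j k => ∑ x, u x * v j x * v k x) =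
        A.transpose * (Matrix.of fun j k => ∑ x, u x * ((b j : V) : EuclideanSpace ℝ X) x *
          ((b k : V) : EuclideanSpace ℝ X) x) * A := by
      intro u
      rw [Matrix.of_gram_eq u v, Matrix.of_gram_eq u fun j x => ((b j : V) : EuclideanSpace ℝ X) x,
        hvQ, Matrix.transpose_mul]
      simp only [Matrix.mul_assoc, Q]
    have hone : (Matrix.of fun j k => ∑ x, 1 * ((b j : V) : EuclideanSpace ℝ X) x *
          ((b k : V) : EuclideanSpace ℝ X) x) = 1 := by
      ext j k
      have := orthonormal_iff_ite.1 b.orthonormal j k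
      rw [Submodule.coe_inner, PiLp.inner_apply] at this
      rw [Matrix.of_apply, Matrix.one_apply, ← this]
      refine Finset.sum_congr rfl fun x _ => ?_
      simp [mul_comm]
    set H : Matrix (Fin N) (Fin N) ℝ := Matrix.of fun j k => ∑ x, (if x ∈ W then 2 else 1) *
      ((b j : V) : EuclideanSpace ℝ X) x * ((b k : V) : EuclideanSpace ℝ X) x with hH
    have hHpos : H.PosSemidef := by
      rw [hH, Matrix.of_gram_eq (fun x => if x ∈ W then 2 else 1) fun j x =>
        ((b j : V) : EuclideanSpace ℝ X) x]
      refine Matrix.PosSemidef.conjTranspose_mul_mul_same (Matrix.PosSemidef.diagonal fun x => ?_) Q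
      dsimp only
      split_ifs <;> norm_num
    -- In the orthonormal basis the undoubled Gram matrix is the identity, so the excess trace is
    -- exactly the mass on `W`.
    have htr : H.trace - N = ∑ x ∈ W, ∑ k, ((b k : V) : EuclideanSpace ℝ X) x ^ 2 := by
      have h1 : ∀ k, ∑ x, ((b k : V) : EuclideanSpace ℝ X) x ^ 2 = 1 := by
        intro k
        have := congrFun (congrFun hone k) k
        simpa [sq] using this
      have h2 : ∀ k, H k k = 1 + ∑ x ∈ W, ((b k : V) : EuclideanSpace ℝ X) x ^ 2 := by
        intro k
        have h3 : ∑ x ∈ W, ((b k : V) : EuclideanSpace ℝ X) x ^ 2 =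
            ∑ x, if x ∈ W then ((b k : V) : EuclideanSpace ℝ X) x ^ 2 else 0 := by simp
        rw [← h1 k, hH, Matrix.of_apply, h3, ← Finset.sum_add_distrib]
        refine Finset.sum_congr rfl fun x _ => ?_
        split_ifs <;> ring
      rw [Finset.sum_comm, Matrix.trace]
      simp [h2, Finset.sum_add_distrib]
    have hdet : H.det ≤ Real.exp (2 * (r + ∑ x ∈ W, ∑ y, C x y ^ 2)) :=
      hHpos.det_le_exp_trace_sub.trans (Real.exp_le_exp.2 (htr ▸ hmain))
    rw [hG, hG (fun _ => 1), hone]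
    simp only [Matrix.det_mul, Matrix.det_transpose, Matrix.det_one]
    nlinarith [mul_le_mul_of_nonneg_left hdet (mul_self_nonneg A.det)]
  -- Linearly dependent functions make both Gram determinants vanish.
  · obtain ⟨c, hc, hc0⟩ := Fintype.not_linearIndependent_iff.1 hli
    have hzero : ∀ x, ∑ j, c j * v j x = 0 := by
      intro x
      have := congrArg (fun f : EuclideanSpace ℝ X => f x) hc
      simpa [he] using this
    have hdet : ∀ u : X → ℝ, (Matrix.of fun j k => ∑ x, u x * v j x * v k x).det = 0 := by
      intro u
      refine Matrix.exists_mulVec_eq_zero_iff.1 ⟨c, ?_, ?_⟩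
      · rintro rfl; simp at hc0
      · ext j
        simp only [Matrix.mulVec, dotProduct, Matrix.of_apply, Finset.sum_mul, Pi.zero_apply]
        rw [Finset.sum_comm]
        refine Finset.sum_eq_zero fun x _ => ?_
        have : ∀ k, u x * v j x * v k x * c k = u x * v j x * (c k * v k x) := fun k => by ring
        simp_rw [this, ← Finset.mul_sum, hzero, mul_zero]
    rw [hdet, hdet (fun _ => 1), mul_zero]

/-! ### Two-sided bounds for the Gamma function along shifts by integers. -/

theorem Complex.Gamma_add_natCast_succ_eq (a : ℂ) (ha : -1 < a.re) (ha0 : a ≠ 0) (n : ℕ) :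
    Complex.Gamma (a + (n + 1)) = (∏ j ∈ Finset.range (n + 1), (a + j)) * Complex.Gamma a := by
  induction n with
  | zero => simp [Complex.Gamma_add_one a ha0]
  | succ n ih =>
    have h : a + (n + 1) ≠ 0 := fun h => by
      have := congrArg Complex.re h
      simp at this
      linarith [(Nat.cast_nonneg n : (0 : ℝ) ≤ n)]
    rw [Finset.prod_range_succ, mul_right_comm, ← ih]
    push_cast
    rw [show a + (n + 1 + 1 : ℂ) = (a + (n + 1)) + 1 by ring, Complex.Gamma_add_one _ h, mul_comm]

-- Euler's limit formula shows that the quotient of the two sides tends to 1; a positive convergent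
-- sequence with nonzero limit is bounded, and so is its inverse.
open Filter Topology in
theorem Complex.exists_norm_Gamma_add_natCast_succ_bounds (a : ℂ) (ha : -1 < a.re) :
    ∃ C : ℝ, 0 < C ∧ ∀ n : ℕ,
      ‖Complex.Gamma (a + (n + 1))‖ ≤ C * (n.factorial * ((n : ℝ) + 1) ^ a.re) ∧
      n.factorial * ((n : ℝ) + 1) ^ a.re ≤ C * ‖Complex.Gamma (a + (n + 1))‖ := by
  set d : ℕ → ℝ := fun n => n.factorial * ((n : ℝ) + 1) ^ a.re with hd
  have hdpos : ∀ n, 0 < d n := fun n => by positivity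
  set r : ℕ → ℝ := fun n => ‖Complex.Gamma (a + (n + 1))‖ / d n with hr
  have hGpos : ∀ n : ℕ, 0 < ‖Complex.Gamma (a + (n + 1))‖ := fun n => by
    rw [norm_pos_iff]
    apply Complex.Gamma_ne_zero_of_re_pos
    simp
    linarith [(Nat.cast_nonneg n : (0 : ℝ) ≤ n)]
  have hrpos : ∀ n, 0 < r n := fun n => div_pos (hGpos n) (hdpos n)
  have hlim : Tendsto r atTop (𝓝 1) := by
    -- Gamma has a pole at 0, so Euler's limit cannot be divided by there; but then the quotient is
    -- identically 1.
    by_cases ha0 : a = 0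
    · have : r = fun _ => 1 := by
        funext n
        simp only [hr, hd, ha0, zero_add, Complex.Gamma_nat_eq_factorial, Complex.zero_re,
          Real.rpow_zero, mul_one, Complex.norm_natCast]
        exact div_self (by positivity)
      rw [this]
      exact tendsto_const_nhds
    · have hΓ : Complex.Gamma a ≠ 0 := by
        have := hGpos 0
        rw [norm_pos_iff] at this
        simp only [CharP.cast_eq_zero, zero_add, Complex.Gamma_add_one a ha0] at this
        exact right_ne_zero_of_mul this
      have h1 : Tendsto (fun n => ‖Complex.Gamma a‖ / ‖Complex.GammaSeq a n‖) atTop (𝓝 1) := by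
        have := (Complex.GammaSeq_tendsto_Gamma a).norm
        have h := (tendsto_const_nhds (x := ‖Complex.Gamma a‖)).div this (norm_ne_zero_iff.2 hΓ)
        rwa [div_self (norm_ne_zero_iff.2 hΓ)] at h
      have h2 : Tendsto (fun n : ℕ => ((n : ℝ) / (n + 1)) ^ a.re) atTop (𝓝 1) := by
        have := (tendsto_natCast_div_add_atTop (1 : ℝ)).rpow_const (p := a.re) (Or.inl one_ne_zero)
        simpa using this
      have h3 := h1.mul h2
      rw [mul_one] at h3
      refine h3.congr' ?_
      filter_upwards [eventually_gt_atTop 0] with n hn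
      have hn' : (0 : ℝ) < n := Nat.cast_pos.2 hn
      have hprod : (∏ j ∈ Finset.range (n + 1), (a + j)) ≠ 0 := by
        have := hGpos n
        rw [norm_pos_iff, Complex.Gamma_add_natCast_succ_eq a ha ha0] at this
        exact left_ne_zero_of_mul this
      simp only [hr, hd, Complex.Gamma_add_natCast_succ_eq a ha ha0, Complex.GammaSeq, norm_div,
        norm_mul, Complex.norm_natCast]
      rw [Complex.norm_natCast_cpow_of_pos hn, Real.div_rpow hn'.le (by positivity)]
      have h5 : (n : ℝ) ^ a.re ≠ 0 := (Real.rpow_pos_of_pos hn' _).ne'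
      have h6 : ((n : ℝ) + 1) ^ a.re ≠ 0 := (Real.rpow_pos_of_pos (by positivity) _).ne'
      have h7 : (n.factorial : ℝ) ≠ 0 := by positivity
      have h8 := norm_ne_zero_iff.2 hprod
      field_simp
  obtain ⟨C1, hC1⟩ := hlim.bddAbove_range
  obtain ⟨C2, hC2⟩ := (hlim.inv₀ one_ne_zero).bddAbove_range
  refine ⟨max C1 C2, lt_of_lt_of_le (hrpos 0) ((hC1 ⟨0, rfl⟩).trans (le_max_left _ _)),
    fun n => ⟨?_, ?_⟩⟩
  · have : r n ≤ max C1 C2 := (hC1 ⟨n, rfl⟩).trans (le_max_left _ _)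
    rwa [hr, div_le_iff₀ (hdpos n)] at this
  · have : (r n)⁻¹ ≤ max C1 C2 := (hC2 ⟨n, rfl⟩).trans (le_max_right _ _)
    rw [hr] at this
    simp only [inv_div] at this
    rwa [div_le_iff₀ (hGpos n)] at this

/-- Euler's reflection formula, with the shift by `x` removed from the sine by antiperiodicity. At a
pole of `Gamma` the left side is 0 by convention. -/
theorem Complex.inv_norm_Gamma_sub_natCast_le {z : ℂ} (hz : z.re ≤ 0) (x : ℕ) :
    ‖Complex.Gamma (z - x)‖⁻¹ ≤
      ‖Complex.sin (Real.pi * z)‖ / Real.pi * ‖Complex.Gamma (-z + (x + 1))‖ := by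
  by_cases h0 : Complex.Gamma (z - x) = 0
  · rw [h0, norm_zero, inv_zero]
    positivity
  have h1 := Complex.Gamma_mul_Gamma_one_sub (z - x)
  rw [show 1 - (z - x) = -z + (x + 1) by ring, show Real.pi * (z - x) = Real.pi * z - x * Real.pi by
    ring, Complex.sin_antiperiodic.sub_nat_mul_eq] at h1
  have hre : Complex.Gamma (-z + (x + 1)) ≠ 0 := by
    apply Complex.Gamma_ne_zero_of_re_pos
    simp
    linarith [(Nat.cast_nonneg x : (0 : ℝ) ≤ x)]
  have h2 := congrArg norm h1
  rw [norm_mul, norm_div, norm_mul, norm_pow, norm_neg, norm_one, one_pow, one_mul,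
    Complex.norm_real, Real.norm_of_nonneg Real.pi_pos.le] at h2
  have hpos := norm_pos_iff.2 h0
  by_cases hs : ‖Complex.sin (Real.pi * z)‖ = 0
  · rw [hs, div_zero] at h2
    exact absurd h2 (mul_ne_zero hpos.ne' (norm_ne_zero_iff.2 hre))
  · have hs' : 0 < ‖Complex.sin (Real.pi * z)‖ := lt_of_le_of_ne (norm_nonneg _) (Ne.symm hs)
    rw [inv_le_iff_one_le_mul₀ hpos]
    apply le_of_eq
    rw [eq_div_iff hs] at h2
    field_simp
    linarith

/-! ### Interpolation from the negative integers and its regularized kernel. -/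

theorem Lagrange.abs_nodalWeight_neg_succ {M a : ℕ} (ha : a < M) :
    |Lagrange.nodalWeight (Finset.range M) (fun b : ℕ => -((b : ℝ) + 1)) a| =
      ((a.factorial : ℝ) * (M - 1 - a).factorial)⁻¹ := by
  have hsplit : (Finset.range M).erase a = Finset.range a ∪ Finset.Ico (a + 1) M := by
    ext b
    simp only [Finset.mem_erase, Finset.mem_range, Finset.mem_union, Finset.mem_Ico]
    omega
  have hdisj : Disjoint (Finset.range a) (Finset.Ico (a + 1) M) := by
    rw [Finset.disjoint_left]
    intro b
    simp only [Finset.mem_range, Finset.mem_Ico]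
    omega
  rw [Lagrange.nodalWeight, hsplit, Finset.prod_union hdisj, abs_mul, Finset.abs_prod,
    Finset.abs_prod, mul_inv]
  congr 1
  · simp only [abs_inv]
    rw [Finset.prod_inv_distrib, ← Finset.prod_range_add_one_eq_factorial, ← Finset.prod_range_reflect]
    push_cast
    congr 1
    refine Finset.prod_congr rfl fun b hb => ?_
    rw [Finset.mem_range] at hb
    have hb' : (b : ℝ) + 1 ≤ a := by exact_mod_cast hb
    rw [Nat.sub_sub, Nat.cast_sub (by omega)]
    push_cast
    rw [abs_of_nonpos (by linarith)]
    ring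
  · simp only [abs_inv]
    rw [Finset.prod_inv_distrib, ← Finset.prod_range_add_one_eq_factorial,
      Finset.prod_Ico_eq_prod_range, show M - 1 - a = M - (a + 1) by omega]
    push_cast
    congr 1
    refine Finset.prod_congr rfl fun b _ => ?_
    rw [abs_of_nonneg (by linarith [(Nat.cast_nonneg b : (0 : ℝ) ≤ b)])]
    ring

/-- The square root of the one-particle weight of the `(z, w)`-ensemble. -/
noncomputable def zwAmplitude (z w : ℂ) (M : ℕ) (x : ℤ) : ℝ :=
  ‖1 / (Complex.Gamma (z - x) * Complex.Gamma (w + (M : ℂ) + 1 + x))‖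

theorem zwAmplitude_neg_succ_pos {z w : ℂ} (hz : -1 < z.re) (hw : 0 ≤ w.re) {M a : ℕ}
    (ha : a < M) : 0 < zwAmplitude z w M (-((a : ℤ) + 1)) := by
  rw [zwAmplitude, norm_pos_iff]
  have ha' : (a : ℝ) + 1 ≤ M := by exact_mod_cast ha
  refine one_div_ne_zero (mul_ne_zero ?_ ?_) <;> apply Complex.Gamma_ne_zero_of_re_pos
  · simp
    linarith [(Nat.cast_nonneg a : (0 : ℝ) ≤ a)]
  · simp
    linarith

/-- All factorials cancel between the Gamma factors, the nodal polynomial and the nodal weights;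
only the powers coming from the real parts of `z` and `w` survive. -/
theorem exists_interpolation_kernel_bound {z w : ℂ} (hz : -1 < z.re) (hz0 : z.re ≤ 0)
    (hw : 0 ≤ w.re) :
    ∃ K : ℝ, 0 < K ∧ ∀ M a x : ℕ, a < M →
      (zwAmplitude z w M x * ∏ b ∈ Finset.range M, ((x : ℝ) + b + 1)) *
        (|Lagrange.nodalWeight (Finset.range M) (fun b : ℕ => -((b : ℝ) + 1)) a| /
          zwAmplitude z w M (-((a : ℤ) + 1))) ≤ K * (((x : ℝ) + 1) / (a + 1)) ^ (-z.re) := by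
  obtain ⟨C1, hC1, h1⟩ := Complex.exists_norm_Gamma_add_natCast_succ_bounds (-z)
    (by simp; linarith)
  obtain ⟨C2, hC2, h2⟩ := Complex.exists_norm_Gamma_add_natCast_succ_bounds w (by linarith)
  obtain ⟨C3, hC3, h3⟩ := Complex.exists_norm_Gamma_add_natCast_succ_bounds z hz
  set S : ℝ := ‖Complex.sin (Real.pi * z)‖ / Real.pi with hS
  have hS0 : 0 ≤ S := by positivity
  -- `S` vanishes when `z` is an integer; `S + 1` keeps the constant positive.
  refine ⟨(S + 1) * C1 * C2 * (C3 * C2), by positivity, fun M a x ha => ?_⟩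
  set s : ℝ := -z.re with hs
  set u : ℝ := w.re with hu
  have hMa : (a : ℝ) + 1 ≤ M := by exact_mod_cast ha
  have hx0 : (0 : ℝ) ≤ x := Nat.cast_nonneg x
  have ha0 : (0 : ℝ) ≤ a := Nat.cast_nonneg a
  have hG : zwAmplitude z w M x * ∏ b ∈ Finset.range M, ((x : ℝ) + b + 1) ≤
      (S + 1) * C1 * C2 * (((x : ℝ) + 1) ^ s / ((M : ℝ) + x + 1) ^ u) := by
    have e1 : ‖Complex.Gamma (z - x)‖⁻¹ ≤ (S + 1) * (C1 * (x.factorial * ((x : ℝ) + 1) ^ s)) := by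
      refine (Complex.inv_norm_Gamma_sub_natCast_le hz0 x).trans ?_
      have := (h1 x).1
      rw [Complex.neg_re] at this
      gcongr
      linarith
    have e2 : ‖Complex.Gamma (w + (M : ℂ) + 1 + x)‖⁻¹ ≤
        C2 / ((M + x).factorial * ((M : ℝ) + x + 1) ^ u) := by
      have h := (h2 (M + x)).2
      push_cast at h
      rw [show w + (M : ℂ) + 1 + x = w + (M + x + 1) by ring]
      have hp : 0 < ((M + x).factorial : ℝ) * ((M : ℝ) + x + 1) ^ u := by positivity
      have hq : 0 < ‖Complex.Gamma (w + (M + x + 1))‖ := by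
        by_contra hcon
        have : ‖Complex.Gamma (w + (M + x + 1))‖ = 0 := le_antisymm (not_lt.1 hcon) (norm_nonneg _)
        rw [this, mul_zero] at h
        linarith
      rw [inv_le_iff_one_le_mul₀ hq, div_mul_eq_mul_div, one_le_div hp]
      exact h
    have e3 : ∏ b ∈ Finset.range M, ((x : ℝ) + b + 1) = (M + x).factorial / x.factorial := by
      rw [eq_div_iff (by positivity), mul_comm, add_comm M x]
      have := Nat.factorial_mul_ascFactorial x M
      rw [← this, Nat.ascFactorial_eq_prod_range]
      push_cast
      congr 1
      exact Finset.prod_congr rfl fun b _ => by ring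
    have e4 : zwAmplitude z w M x =
        ‖Complex.Gamma (z - x)‖⁻¹ * ‖Complex.Gamma (w + (M : ℂ) + 1 + x)‖⁻¹ := by
      simp [zwAmplitude, mul_comm]
    rw [e3, e4]
    calc _ ≤ ((S + 1) * (C1 * (x.factorial * ((x : ℝ) + 1) ^ s))) *
        (C2 / ((M + x).factorial * ((M : ℝ) + x + 1) ^ u)) *
        ((M + x).factorial / x.factorial) := by gcongr
      _ = _ := by
        have h6 : ((M : ℝ) + x + 1) ^ u ≠ 0 := (Real.rpow_pos_of_pos (by positivity) _).ne'
        field_simp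
  have hB : |Lagrange.nodalWeight (Finset.range M) (fun b : ℕ => -((b : ℝ) + 1)) a| /
      zwAmplitude z w M (-((a : ℤ) + 1)) ≤
        C3 * C2 * (((M : ℝ) - a) ^ u / ((a : ℝ) + 1) ^ s) := by
    have e1 := (h3 a).1
    have e2 := (h2 (M - 1 - a)).1
    have hcast : ((M - 1 - a : ℕ) : ℝ) + 1 = (M : ℝ) - a := by
      rw [Nat.sub_sub, Nat.cast_sub (by omega)]
      push_cast
      ring
    have hcast' : ((M - 1 - a : ℕ) : ℂ) + 1 = (M : ℂ) - a := by
      rw [Nat.sub_sub, Nat.cast_sub (by omega)]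
      push_cast
      ring
    rw [hcast, hcast'] at e2
    have e3 : (zwAmplitude z w M (-((a : ℤ) + 1)))⁻¹ =
        ‖Complex.Gamma (z + (a + 1))‖ * ‖Complex.Gamma (w + (M - a))‖ := by
      rw [zwAmplitude, one_div, norm_inv, inv_inv, norm_mul]
      push_cast
      rw [sub_neg_eq_add, show w + (M : ℂ) + 1 + -((a : ℂ) + 1) = w + (M - a) by ring]
    rw [div_eq_mul_inv, e3, Lagrange.abs_nodalWeight_neg_succ ha]
    have hz' : ((a : ℝ) + 1) ^ z.re = (((a : ℝ) + 1) ^ s)⁻¹ := by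
      rw [← Real.rpow_neg (by positivity), hs, neg_neg]
    rw [hz'] at e1
    calc _ ≤ ((a.factorial : ℝ) * (M - 1 - a).factorial)⁻¹ *
        ((C3 * (a.factorial * (((a : ℝ) + 1) ^ s)⁻¹)) *
          (C2 * ((M - 1 - a).factorial * ((M : ℝ) - a) ^ u))) := by gcongr
      _ = _ := by
        have h6 : ((a : ℝ) + 1) ^ s ≠ 0 := (Real.rpow_pos_of_pos (by positivity) _).ne'
        field_simp
  have hb0 : 0 ≤ |Lagrange.nodalWeight (Finset.range M) (fun b : ℕ => -((b : ℝ) + 1)) a| /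
      zwAmplitude z w M (-((a : ℤ) + 1)) := div_nonneg (abs_nonneg _) (norm_nonneg _)
  refine (mul_le_mul hG hB hb0 (by positivity)).trans ?_
  -- The powers governed by `w` can be discarded because `0 ≤ w.re`, which removes all dependence on
  -- `M`.
  have hratio : (((M : ℝ) - a) ^ u / ((M : ℝ) + x + 1) ^ u) ≤ 1 := by
    rw [div_le_one (by positivity)]
    exact Real.rpow_le_rpow (by linarith) (by linarith) hw
  rw [Real.div_rpow (by positivity) (by positivity)]
  calc _ = (S + 1) * C1 * C2 * (C3 * C2) * (((x : ℝ) + 1) ^ s / ((a : ℝ) + 1) ^ s) *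
        (((M : ℝ) - a) ^ u / ((M : ℝ) + x + 1) ^ u) := by ring
    _ ≤ _ := mul_le_of_le_one_right (by positivity) hratio

/-- Telescoping, from `1/m² ≤ 2/m - 2/(m+1)` for `m ≥ 1`. -/
theorem sum_inv_add_succ_sq_le (a n : ℕ) :
    ∑ x ∈ Finset.range n, 1 / ((x : ℝ) + a + 1) ^ 2 ≤ 2 / ((a : ℝ) + 1) := by
  have h : ∑ x ∈ Finset.range n, 1 / ((x : ℝ) + a + 1) ^ 2 ≤
      2 / ((a : ℝ) + 1) - 2 / ((n : ℝ) + a + 1) := by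
    induction n with
    | zero => simp
    | succ n ih =>
      rw [Finset.sum_range_succ]
      have h1 : 1 / ((n : ℝ) + a + 1) ^ 2 ≤
          2 / ((n : ℝ) + a + 1) - 2 / (((n + 1 : ℕ) : ℝ) + a + 1) := by
        push_cast
        have hm : (1 : ℝ) ≤ (n : ℝ) + a + 1 := by
          linarith [(Nat.cast_nonneg n : (0 : ℝ) ≤ n), (Nat.cast_nonneg a : (0 : ℝ) ≤ a)]
        rw [show (n : ℝ) + 1 + a + 1 = ((n : ℝ) + a + 1) + 1 by ring]
        generalize (n : ℝ) + a + 1 = m at hm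
        rw [div_sub_div _ _ (by positivity) (by positivity),
          div_le_div_iff₀ (by positivity) (by positivity)]
        nlinarith
      linarith
  have : (0 : ℝ) ≤ 2 / ((n : ℝ) + a + 1) := by positivity
  linarith

/-- Subtracting the value at `a = 0` below the dyadic scale of `x` regularizes the kernel
`t ^ s / (x + a + 1)`, `t = (x + 1) / (a + 1)`, `0 ≤ s ≤ 1`. -/
theorem rpow_mul_abs_regularized_le {s : ℝ} (hs : s ≤ 1) (hs0 : 0 ≤ s) (J : ℕ) {a : ℕ}
    (ha : a < 2 ^ J) (x : ℕ) :
    (((x : ℝ) + 1) / (a + 1)) ^ s * |1 / ((x : ℝ) + a + 1) -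
      (if a < 2 ^ (min (Nat.log 2 (x + 1)) J) then 1 / ((x : ℝ) + 1) else 0)| ≤
        2 * (1 / ((x : ℝ) + a + 1)) := by
  have hx0 : (0 : ℝ) ≤ x := Nat.cast_nonneg x
  have ha0 : (0 : ℝ) ≤ a := Nat.cast_nonneg a
  split_ifs with h
  -- Here `t ≥ 1`, so `t ^ s ≤ t`; the subtraction gains a factor `a / (x + 1)`, which compensates
  -- for `t`.
  · have h1 : a + 1 ≤ x + 1 := by
      have h2 : 2 ^ (min (Nat.log 2 (x + 1)) J) ≤ 2 ^ Nat.log 2 (x + 1) :=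
        Nat.pow_le_pow_right (by norm_num) (min_le_left _ _)
      have h3 := Nat.pow_log_le_self 2 (Nat.succ_ne_zero x)
      simp only [Nat.succ_eq_add_one] at h3
      omega
    have h1' : (a : ℝ) + 1 ≤ x + 1 := by exact_mod_cast h1
    have h4 : (((x : ℝ) + 1) / (a + 1)) ^ s ≤ ((x : ℝ) + 1) / (a + 1) := by
      have : 1 ≤ ((x : ℝ) + 1) / (a + 1) := by rwa [one_le_div (by positivity)]
      simpa using Real.rpow_le_rpow_of_exponent_le this hs
    have h5 : |1 / ((x : ℝ) + a + 1) - 1 / ((x : ℝ) + 1)| =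
        a / (((x : ℝ) + a + 1) * (x + 1)) := by
      rw [div_sub_div _ _ (by positivity) (by positivity), abs_div,
        abs_of_pos (by positivity : 0 < ((x : ℝ) + a + 1) * (x + 1))]
      congr 1
      rw [abs_of_nonpos (by linarith)]
      ring
    rw [h5]
    calc _ ≤ ((x : ℝ) + 1) / (a + 1) * (a / (((x : ℝ) + a + 1) * (x + 1))) := by gcongr
      _ = a / (a + 1) * (1 / ((x : ℝ) + a + 1)) := by field_simp
      _ ≤ 2 * (1 / ((x : ℝ) + a + 1)) := by
        gcongr
        rw [div_le_iff₀ (by positivity)]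
        linarith
  -- Above the dyadic scale of `x` nothing is subtracted, but `t ≤ 2`. If the cap `J` is attained,
  -- this case is empty since `a < 2 ^ J`.
  · have h1 : x + 1 ≤ 2 * (a + 1) := by
      rcases le_total (Nat.log 2 (x + 1)) J with hJ | hJ
      · rw [min_eq_left hJ, not_lt] at h
        have h3 := Nat.lt_pow_succ_log_self (b := 2) (by norm_num) (x + 1)
        rw [pow_succ] at h3
        omega
      · rw [min_eq_right hJ] at h
        exact absurd ha h
    have h1' : (x : ℝ) + 1 ≤ 2 * (a + 1) := by exact_mod_cast h1
    have h4 : (((x : ℝ) + 1) / (a + 1)) ^ s ≤ 2 := by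
      have h5 : ((x : ℝ) + 1) / (a + 1) ≤ 2 := by rwa [div_le_iff₀ (by positivity)]
      calc (((x : ℝ) + 1) / (a + 1)) ^ s ≤ 2 ^ s := Real.rpow_le_rpow (by positivity) h5 hs0
        _ ≤ 2 ^ (1 : ℝ) := Real.rpow_le_rpow_of_exponent_le (by norm_num) hs
        _ = 2 := Real.rpow_one 2
    rw [sub_zero, abs_of_pos (by positivity)]
    gcongr

/-- Barycentric Lagrange interpolation; placing the nodes at `-1, …, -M` produces the Hilbert-type
kernel `1 / (x + a + 1)`. -/
theorem Polynomial.eval_eq_sum_neg_succ {M : ℕ} {P : Polynomial ℝ} (hP : P.degree < M) (x : ℕ) :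
    P.eval (x : ℝ) = (∏ b ∈ Finset.range M, ((x : ℝ) + b + 1)) * ∑ a ∈ Finset.range M,
      Lagrange.nodalWeight (Finset.range M) (fun b : ℕ => -((b : ℝ) + 1)) a *
        ((x : ℝ) + a + 1)⁻¹ * P.eval (-((a : ℝ) + 1)) := by
  have hinj : Set.InjOn (fun b : ℕ => -((b : ℝ) + 1)) (Finset.range M : Set ℕ) := by
    intro a _ b _ h
    simpa using h
  have h1 := Lagrange.eq_interpolate (s := Finset.range M) hinj (f := P) (by simpa using hP)
  conv_lhs => rw [h1]
  rw [Lagrange.eval_interpolate_not_at_node, Lagrange.eval_nodal]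
  · congr 1
    · exact Finset.prod_congr rfl fun b _ => by ring
    · exact Finset.sum_congr rfl fun a _ => by
        rw [show (x : ℝ) - -((a : ℝ) + 1) = x + a + 1 by ring]
  · intro i _ h
    have : (0 : ℝ) ≤ x := Nat.cast_nonneg x
    have : (0 : ℝ) ≤ i := Nat.cast_nonneg i
    linarith

/-- Extension of the kernel by zero off the nodes. -/
theorem Finset.exists_kernel_of_injective {ι X : Type*} [Fintype ι] [Fintype X] {n : ι → X}
    (hn : Function.Injective n) (c : X → ι → ℝ) :
    ∃ C : X → X → ℝ, (∀ x (f : X → ℝ), ∑ y, C x y * f y = ∑ a, c x a * f (n a)) ∧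
      ∀ x, ∑ y, C x y ^ 2 = ∑ a, c x a ^ 2 := by
  refine ⟨fun x => Function.extend n (c x) 0, fun x f => ?_, fun x => ?_⟩
  · refine (Fintype.sum_of_injective n hn _ _ (fun y hy => ?_) fun a => ?_).symm
    · dsimp only
      rw [Function.extend_apply' _ _ _ (by simpa using hy)]
      simp
    · dsimp only
      rw [hn.extend_apply]
  · refine (Fintype.sum_of_injective n hn _ _ (fun y hy => ?_) fun a => ?_).symm
    · dsimp only
      rw [Function.extend_apply' _ _ _ (by simpa using hy)]
      simp
    · dsimp only
      rw [hn.extend_apply]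

theorem sum_nonneg_int_inv_sq_le (S : Finset ℤ) (a : ℕ) :
    ∑ x ∈ Finset.univ.filter (fun x : S => 0 ≤ (x : ℤ)),
      1 / (((x : ℤ).toNat : ℝ) + a + 1) ^ 2 ≤ 2 / ((a : ℝ) + 1) := by
  set W := Finset.univ.filter (fun x : S => 0 ≤ (x : ℤ)) with hW
  obtain ⟨n, hn⟩ := Finset.exists_nat_subset_range (W.image fun x : S => (x : ℤ).toNat)
  have hinj : Set.InjOn (fun x : S => (x : ℤ).toNat) (W : Set S) := by
    intro x hx y hy h
    simp only [hW, Finset.coe_filter, Finset.mem_univ, true_and, Set.mem_ofPred_eq] at hx hy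
    ext
    have h' : (x : ℤ).toNat = (y : ℤ).toNat := h
    omega
  have := Finset.sum_image (s := W) (g := fun x : S => (x : ℤ).toNat)
    (f := fun m : ℕ => 1 / ((m : ℝ) + a + 1) ^ 2) hinj
  rw [← this]
  refine le_trans ?_ (sum_inv_add_succ_sq_le a n)
  exact Finset.sum_le_sum_of_subset_of_nonneg hn fun _ _ _ => by positivity

/-- One condition lowers the degree below the number `M` of nodes. The other `J + 1` annihilate the
weighted partial sums over `a < 2 ^ k`, so that a multiple of such a sum, depending on `x`, can be
subtracted from the interpolation formula for free. -/
theorem exists_regularized_interpolation {z w : ℂ} (hz : -1 < z.re) (hz0 : z.re ≤ 0)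
    (hw : 0 ≤ w.re) :
    ∃ K : ℝ, 0 < K ∧ ∀ M J : ℕ, M ≤ 2 ^ J →
      ∃ (l : (Fin (M + 1) → ℝ) →ₗ[ℝ] (Fin (J + 2) → ℝ)) (c : ℕ → Fin M → ℝ),
        (∀ x a, |c x a| ≤ K * (1 / ((x : ℝ) + (a : ℕ) + 1))) ∧
        ∀ d, l d = 0 → ∀ x : ℕ,
          ∑ j : Fin (M + 1), d j * (zwAmplitude z w M x * ((x : ℤ) : ℝ) ^ (j : ℕ)) =
            ∑ a, c x a * ∑ j : Fin (M + 1), d j * (zwAmplitude z w M (-(((a : ℕ) : ℤ) + 1)) *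
              ((-(((a : ℕ) : ℤ) + 1) : ℤ) : ℝ) ^ (j : ℕ)) := by
  obtain ⟨K, hK, hbound⟩ := exists_interpolation_kernel_bound hz hz0 hw
  refine ⟨K * 2, by positivity, fun M J hMJ => ?_⟩
  set f : (Fin (M + 1) → ℝ) → ℤ → ℝ := fun d y =>
    ∑ j : Fin (M + 1), d j * (zwAmplitude z w M y * (y : ℝ) ^ (j : ℕ)) with hf
  set g : ℕ → ℝ := fun x => zwAmplitude z w M x * ∏ b ∈ Finset.range M, ((x : ℝ) + b + 1) with hg
  set β : ℕ → ℝ := fun a =>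
    Lagrange.nodalWeight (Finset.range M) (fun b : ℕ => -((b : ℝ) + 1)) a /
      zwAmplitude z w M (-((a : ℤ) + 1)) with hβ
  let F : Fin M → (Fin (M + 1) → ℝ) →ₗ[ℝ] ℝ := fun a => ∑ j : Fin (M + 1),
    (zwAmplitude z w M (-(((a : ℕ) : ℤ) + 1)) *
      ((-(((a : ℕ) : ℤ) + 1) : ℤ) : ℝ) ^ (j : ℕ)) • LinearMap.proj j
  have hF : ∀ a d, F a d = f d (-(((a : ℕ) : ℤ) + 1)) := fun a d => by
    simp only [F, hf, LinearMap.sum_apply, LinearMap.smul_apply, LinearMap.proj_apply, smul_eq_mul]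
    exact Finset.sum_congr rfl fun j _ => mul_comm _ _
  let l : (Fin (M + 1) → ℝ) →ₗ[ℝ] (Fin (J + 2) → ℝ) := LinearMap.pi
    (Fin.cons (LinearMap.proj (Fin.last M))
      fun k : Fin (J + 1) => ∑ a : Fin M, (if (a : ℕ) < 2 ^ (k : ℕ) then β a else 0) • F a)
  have hl0 : ∀ d, l d 0 = d (Fin.last M) := fun d => rfl
  have hl : ∀ d (k : Fin (J + 1)), l d k.succ =
      ∑ a : Fin M, (if (a : ℕ) < 2 ^ (k : ℕ) then β a else 0) * f d (-(((a : ℕ) : ℤ) + 1)) := by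
    intro d k
    simp only [l, LinearMap.pi_apply, Fin.cons_succ, LinearMap.sum_apply, LinearMap.smul_apply, hF,
      smul_eq_mul]
  refine ⟨l, fun x a => g x * β a * (1 / ((x : ℝ) + (a : ℕ) + 1) -
    (if (a : ℕ) < 2 ^ (min (Nat.log 2 (x + 1)) J) then 1 / ((x : ℝ) + 1) else 0)), ?_, ?_⟩
  · intro x a
    have h1 := hbound M a x a.2
    have h2 := rpow_mul_abs_regularized_le (s := -z.re) (by linarith) (by linarith) J
      (lt_of_lt_of_le a.2 hMJ) x
    have hg0 : 0 ≤ g x := mul_nonneg (norm_nonneg _) (Finset.prod_nonneg fun b _ => by positivity)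
    have h3 : |g x * β a| ≤ K * (((x : ℝ) + 1) / ((a : ℕ) + 1)) ^ (-z.re) := by
      rw [abs_mul, abs_of_nonneg hg0, hβ, abs_div, 
        abs_of_pos (zwAmplitude_neg_succ_pos (w := w) hz hw a.2)]
      exact h1
    rw [abs_mul]
    calc _ ≤ K * (((x : ℝ) + 1) / ((a : ℕ) + 1)) ^ (-z.re) * |1 / ((x : ℝ) + (a : ℕ) + 1) -
        (if (a : ℕ) < 2 ^ (min (Nat.log 2 (x + 1)) J) then 1 / ((x : ℝ) + 1) else 0)| := by gcongr
      _ ≤ K * (2 * (1 / ((x : ℝ) + (a : ℕ) + 1))) := by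
        rw [mul_assoc]
        gcongr
      _ = _ := by ring
  · intro d hd x
    have hlast : d (Fin.last M) = 0 := by
      rw [← hl0 d, hd]
      rfl
    set P : Polynomial ℝ := ∑ i : Fin M, Polynomial.C (d i.castSucc) * Polynomial.X ^ (i : ℕ) with hP
    have hdeg : P.degree < M := Polynomial.degree_sum_fin_lt _
    have hfP : ∀ y : ℤ, f d y = zwAmplitude z w M y * P.eval (y : ℝ) := by
      intro y
      simp only [hf, hP, Polynomial.eval_finsetSum, Fin.sum_univ_castSucc, hlast, zero_mul, add_zero,
        Polynomial.eval_mul, Polynomial.eval_C, Polynomial.eval_pow, Polynomial.eval_X,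
        Finset.mul_sum, Fin.val_castSucc]
      exact Finset.sum_congr rfl fun j _ => by ring
    -- The vanishing condition at the dyadic scale of `x`, capped at `J`, the largest available
    -- cutoff.
    have hk := hl d ⟨min (Nat.log 2 (x + 1)) J, by omega⟩
    rw [hd, Pi.zero_apply] at hk
    have hmain : f d x = ∑ a : Fin M, g x * β a * (1 / ((x : ℝ) + (a : ℕ) + 1)) *
        f d (-(((a : ℕ) : ℤ) + 1)) := by
      rw [hfP, Int.cast_natCast, Polynomial.eval_eq_sum_neg_succ hdeg, ← mul_assoc, Finset.mul_sum,
        Finset.sum_range]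
      refine Finset.sum_congr rfl fun a _ => ?_
      rw [hfP]
      have := (zwAmplitude_neg_succ_pos (z := z) (w := w) hz hw a.2).ne'
      simp only [hg, hβ]
      push_cast
      field_simp
    change f d x = ∑ a : Fin M, _ * f d (-(((a : ℕ) : ℤ) + 1))
    have hsub : ∀ a : Fin M, g x * β a * (1 / ((x : ℝ) + (a : ℕ) + 1) -
        (if (a : ℕ) < 2 ^ (min (Nat.log 2 (x + 1)) J) then 1 / ((x : ℝ) + 1) else 0)) *
          f d (-(((a : ℕ) : ℤ) + 1)) = g x * β a * (1 / ((x : ℝ) + (a : ℕ) + 1)) *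
          f d (-(((a : ℕ) : ℤ) + 1)) - g x * (1 / ((x : ℝ) + 1)) *
            ((if (a : ℕ) < 2 ^ (min (Nat.log 2 (x + 1)) J) then β a else 0) *
              f d (-(((a : ℕ) : ℤ) + 1))) := by
      intro a
      split_ifs <;> ring
    rw [Finset.sum_congr rfl fun a _ => hsub a, Finset.sum_sub_distrib, ← Finset.mul_sum, ← hk,
      mul_zero, sub_zero]
    exact hmain

/-- The constants do not depend on the finite window `S`, which need only contain the nodes; this is
what later permits truncation to finitely many signatures. -/
theorem exists_det_gram_doubled_le {z w : ℂ} (hz : -1 < z.re) (hz0 : z.re ≤ 0) (hw : 0 ≤ w.re) :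
    ∃ A B : ℝ, 0 < A ∧ 0 < B ∧ ∀ (M : ℕ) (S : Finset ℤ),
      (∀ a : Fin M, -(((a : ℕ) : ℤ) + 1) ∈ S) →
      (Matrix.of fun j k : Fin (M + 1) => ∑ x : S, (if 0 ≤ (x : ℤ) then 2 else 1) *
        (zwAmplitude z w M x * ((x : ℤ) : ℝ) ^ (j : ℕ)) *
          (zwAmplitude z w M x * ((x : ℤ) : ℝ) ^ (k : ℕ))).det ≤
      Real.exp (A + B * Real.log ((M : ℝ) + 1)) *
        (Matrix.of fun j k : Fin (M + 1) => ∑ x : S, 1 *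
          (zwAmplitude z w M x * ((x : ℤ) : ℝ) ^ (j : ℕ)) *
            (zwAmplitude z w M x * ((x : ℤ) : ℝ) ^ (k : ℕ))).det := by
  obtain ⟨K, hK, hint⟩ := exists_regularized_interpolation hz hz0 hw
  -- With `L = log (M + 1)`, the codimension is at most `3 + 2L` and the squared kernel norm at most
  -- `2K²(1 + L)`; the exponent is twice their sum.
  refine ⟨6 + 4 * K ^ 2, 4 + 4 * K ^ 2, by positivity, by positivity, fun M S hS => ?_⟩
  obtain ⟨l, c, hc, hl⟩ := hint M (Nat.log 2 M + 1)
    (Nat.lt_pow_succ_log_self (by norm_num) M).le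
  have hninj : Function.Injective fun a : Fin M => (⟨-(((a : ℕ) : ℤ) + 1), hS a⟩ : S) := by
    intro a b hab
    simp only [Subtype.mk.injEq] at hab
    ext
    omega
  obtain ⟨C, hC1, hC2⟩ := Finset.exists_kernel_of_injective hninj fun x a => c (x : ℤ).toNat a
  have hmain := Matrix.det_gram_doubled_le
    (fun (j : Fin (M + 1)) (x : S) => zwAmplitude z w M x * ((x : ℤ) : ℝ) ^ (j : ℕ))
    (Finset.univ.filter fun x : S => 0 ≤ (x : ℤ)) l C (by
      intro d hd x hx
      rw [Finset.mem_filter] at hx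
      rw [hC1, ← hl d hd (x : ℤ).toNat, Int.toNat_of_nonneg hx.2])
  simp only [Finset.mem_filter, Finset.mem_univ, true_and] at hmain
  refine hmain.trans ?_
  have hdet : 0 ≤ (Matrix.of fun j k : Fin (M + 1) => ∑ x : S, 1 *
          (zwAmplitude z w M x * ((x : ℤ) : ℝ) ^ (j : ℕ)) *
            (zwAmplitude z w M x * ((x : ℤ) : ℝ) ^ (k : ℕ))).det := by
    have := Matrix.sum_prod_mul_det_sq (fun _ : S => 1)
      (fun (j : Fin (M + 1)) (x : S) => zwAmplitude z w M x * ((x : ℤ) : ℝ) ^ (j : ℕ))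
    refine nonneg_of_mul_nonneg_right (this ▸ ?_) (by positivity : (0 : ℝ) < (M + 1).factorial)
    exact Finset.sum_nonneg fun x _ => by positivity
  refine mul_le_mul_of_nonneg_right (Real.exp_le_exp.2 ?_) hdet
  simp only [hC2]
  have hM1 : (1 : ℝ) ≤ (M : ℝ) + 1 := by linarith [(Nat.cast_nonneg M : (0 : ℝ) ≤ M)]
  have hlog0 := Real.log_nonneg hM1
  have hr : ((Nat.log 2 M + 1 + 2 : ℕ) : ℝ) ≤ 3 + 2 * Real.log ((M : ℝ) + 1) := by
    have h1 : (Nat.log 2 M : ℝ) ≤ Nat.log 2 (M + 1) := by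
      exact_mod_cast Nat.log_mono_right (Nat.le_succ M)
    have h2 := Real.natLog_le_logb (M + 1) 2
    have h3 : Real.logb 2 ((M : ℝ) + 1) ≤ 2 * Real.log ((M : ℝ) + 1) := by
      rw [Real.logb, div_le_iff₀ (Real.log_pos (by norm_num))]
      nlinarith [Real.log_two_gt_d9]
    push_cast at h2 ⊢
    linarith
  have hHS : ∑ x ∈ Finset.univ.filter (fun x : S => 0 ≤ (x : ℤ)), ∑ a, c (x : ℤ).toNat a ^ 2 ≤
      2 * K ^ 2 * (1 + Real.log ((M : ℝ) + 1)) := by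
    calc _ ≤ ∑ x ∈ Finset.univ.filter (fun x : S => 0 ≤ (x : ℤ)), ∑ a : Fin M,
          K ^ 2 * (1 / (((x : ℤ).toNat : ℝ) + (a : ℕ) + 1) ^ 2) := by
          refine Finset.sum_le_sum fun x _ => Finset.sum_le_sum fun a _ => ?_
          have h := hc (x : ℤ).toNat a
          rw [← sq_abs]
          calc _ ≤ (K * (1 / (((x : ℤ).toNat : ℝ) + (a : ℕ) + 1))) ^ 2 := by gcongr
            _ = _ := by rw [mul_pow, one_div_pow]
      _ ≤ ∑ a : Fin M, K ^ 2 * (2 / (((a : ℕ) : ℝ) + 1)) := by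
          rw [Finset.sum_comm]
          refine Finset.sum_le_sum fun a _ => ?_
          rw [← Finset.mul_sum]
          exact mul_le_mul_of_nonneg_left (sum_nonneg_int_inv_sq_le S a) (by positivity)
      _ = 2 * K ^ 2 * ((harmonic M : ℚ) : ℝ) := by
          rw [← Finset.sum_range (fun a : ℕ => K ^ 2 * (2 / ((a : ℝ) + 1))), harmonic,
            Rat.cast_sum, Finset.mul_sum]
          refine Finset.sum_congr rfl fun a _ => ?_
          push_cast
          ring
      _ ≤ _ := by
          gcongr
          refine (harmonic_le_one_add_log M).trans ?_
          rcases Nat.eq_zero_or_pos M with rfl | hM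
          · simp
          · have : (0 : ℝ) < M := by exact_mod_cast hM
            gcongr
            linarith
  nlinarith

/-! ### Signatures as particle configurations. -/

namespace GTSignature

/-- The strictly decreasing particle configuration `λ_i - i + k` of a signature. -/
def particle {N : ℕ} (k : ℤ) (l : GTSignature N) (i : Fin N) : ℤ :=
  l.row i - ((i : ℕ) + 1) + k

theorem strictAnti_particle {N : ℕ} (k : ℤ) (l : GTSignature N) : StrictAnti (l.particle k) := by
  intro i j hij
  have := l.antitone_row hij.le
  have h : ((i : ℕ) : ℤ) < ((j : ℕ) : ℤ) := by exact_mod_cast hij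
  simp only [particle]
  omega

theorem particle_injective {N : ℕ} (k : ℤ) :
    Function.Injective (particle (N := N) k) := by
  intro l m h
  ext i
  have := congrFun h i
  simp only [particle] at this
  omega

theorem exists_particle_eq {M : ℕ} (k : ℤ) {x : Fin (M + 1) → ℤ} (hx : StrictAnti x) :
    ∃ l : GTSignature (M + 1), l.particle k = x := by
  refine ⟨⟨fun i => x i + ((i : ℕ) + 1) - k, ?_⟩, ?_⟩
  · rw [Fin.antitone_iff_succ_le]
    intro i
    have : x i.succ < x i.castSucc := hx (Fin.castSucc_lt_succ)
    simp only [Fin.val_succ, Fin.val_castSucc]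
    push_cast
    omega
  · ext i
    simp only [particle]
    omega

theorem particle_comp_perm_injective {N : ℕ} (k : ℤ) :
    Function.Injective fun p : GTSignature N × Equiv.Perm (Fin N) => p.1.particle k ∘ p.2 := by
  rintro ⟨l, σ⟩ ⟨m, τ⟩ h
  have h1 : l.particle k = m.particle k ∘ (σ.symm.trans τ) := by
    funext i
    have := congrFun h (σ.symm i)
    simpa using this
  have h2 : StrictMono (σ.symm.trans τ) := by
    intro i j hij
    have h3 := l.strictAnti_particle k hij
    rw [h1] at h3
    exact (m.strictAnti_particle k).lt_iff_gt.1 h3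
  have h4 : ((σ.symm.trans τ : Equiv.Perm (Fin N)) : Fin N → Fin N) = id := by
    rw [← h2.range_inj strictMono_id]
    simp
  have h5 : l = m := particle_injective k (by rw [h1, h4]; rfl)
  have h6 : σ = τ := by
    ext i
    have := congrFun h4 (σ i)
    simp at this
    rw [this]
  rw [h5, h6]

theorem exists_particle_comp_perm_eq {M : ℕ} (k : ℤ) {x : Fin (M + 1) → ℤ}
    (hx : Function.Injective x) :
    ∃ (l : GTSignature (M + 1)) (σ : Equiv.Perm (Fin (M + 1))), l.particle k ∘ σ = x := by
  set y : Fin (M + 1) → ℤ := fun i => -x i with hy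
  have h1 : StrictMono (y ∘ Tuple.sort y) :=
    (Tuple.monotone_sort y).strictMono_of_injective
      ((neg_injective.comp hx).comp (Tuple.sort y).injective)
  obtain ⟨l, hl⟩ := exists_particle_eq k (x := x ∘ Tuple.sort y) (fun i j hij => by
    have h2 : -x (Tuple.sort y i) < -x (Tuple.sort y j) := h1 hij
    simp only [Function.comp_apply]
    omega)
  refine ⟨l, (Tuple.sort y).symm, ?_⟩
  rw [hl]
  funext i
  simp

theorem finite_particle_mem {N : ℕ} (k : ℤ) (S : Finset ℤ) :
    {l : GTSignature N | ∀ i, l.particle k i ∈ S}.Finite := by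
  have h : (Set.pi Set.univ fun _ : Fin N => (S : Set ℤ)).Finite :=
    Set.Finite.pi fun _ => S.finite_toSet
  refine (h.preimage (particle_injective k).injOn).subset ?_
  intro l hl
  simpa using hl

/-- A sum over all tuples of a symmetric function that vanishes off the injective tuples is a sum
over signatures. -/
theorem sum_tuples_eq {M : ℕ} (k : ℤ) (S : Finset ℤ) (F : (Fin (M + 1) → ℤ) → ℝ)
    (hsymm : ∀ x (σ : Equiv.Perm (Fin (M + 1))), F (x ∘ σ) = F x)
    (hinj : ∀ x, ¬ Function.Injective x → F x = 0) :
    ∑ x : Fin (M + 1) → S, F (fun i => x i) =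
      (M + 1).factorial * ∑ l ∈ (finite_particle_mem k S).toFinset, F (particle k l) := by
  classical
  have h1 : ((M + 1).factorial : ℝ) * ∑ l ∈ (finite_particle_mem k S).toFinset, F (particle k l) =
      ∑ p ∈ (finite_particle_mem (N := M + 1) k S).toFinset ×ˢ
        (Finset.univ : Finset (Equiv.Perm (Fin (M + 1)))), F (p.1.particle k ∘ p.2) := by
    rw [Finset.sum_product, Finset.mul_sum]
    refine Finset.sum_congr rfl fun l _ => ?_
    simp [hsymm, Fintype.card_perm]
  rw [h1]
  symm
  refine Finset.sum_bij_ne_zero (fun p hp _ i => ⟨p.1.particle k (p.2 i), ?_⟩) ?_ ?_ ?_ ?_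
  · simp only [Finset.mem_product, Set.Finite.mem_toFinset, Set.mem_ofPred_eq] at hp
    exact hp.1 _
  · intros; simp
  · intro p hp _ q hq _ h
    apply particle_comp_perm_injective k
    funext i
    have := congrFun h i
    simpa using this
  · intro x _ hx
    have hxi : Function.Injective fun i => (x i : ℤ) := by
      by_contra hcon
      exact hx (hinj _ hcon)
    obtain ⟨l, σ, h⟩ := exists_particle_comp_perm_eq k hxi
    refine ⟨(l, σ), ?_, ?_, ?_⟩
    · simp only [Finset.mem_product, Set.Finite.mem_toFinset, Set.mem_ofPred_eq, Finset.mem_univ,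
        and_true]
      intro i
      have := congrFun h (σ.symm i)
      simp only [Function.comp_apply, Equiv.apply_symm_apply] at this
      rw [this]
      exact (x _).2
    · rw [h]; exact hx
    · funext i
      ext
      exact congrFun h i
  · intros; rfl

theorem dim_eq_det_vandermonde {N : ℕ} (k : ℤ) (l : GTSignature N) :
    l.dim ^ 2 = ((∏ i : Fin N, ∏ j ∈ Finset.Ioi i, (((j : ℕ) : ℝ) - ((i : ℕ) : ℝ)))⁻¹) ^ 2 *
      (Matrix.vandermonde fun i => (l.particle k i : ℝ)).det ^ 2 := by
  have h : l.dim = (∏ i : Fin N, ∏ j ∈ Finset.Ioi i, (((j : ℕ) : ℝ) - ((i : ℕ) : ℝ)))⁻¹ *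
      ∏ i : Fin N, ∏ j ∈ Finset.Ioi i, ((l.particle k i : ℝ) - l.particle k j) := by
    simp only [dim, Finset.prod_div_distrib]
    rw [div_eq_inv_mul]
    congr 1
    refine Finset.prod_congr rfl fun i _ => Finset.prod_congr rfl fun j _ => ?_
    simp only [particle]
    push_cast
    ring
  rw [h, mul_pow, Matrix.det_vandermonde]
  congr 1
  simp only [← Finset.prod_pow]
  refine Finset.prod_congr rfl fun i _ => Finset.prod_congr rfl fun j _ => ?_
  ring

/-- Shifting the particles by `k` moves `z` up and `w` down by `k`. The extra 1 in the second
parameter appears because the level is `M + 1` while the amplitude is normalized to the `M`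
interpolation nodes. -/
theorem zwWeight_eq_det {M : ℕ} (z w : ℂ) (k : ℤ) (l : GTSignature (M + 1)) :
    l.zwWeight z w =
      ((∏ i : Fin (M + 1), ∏ j ∈ Finset.Ioi i, (((j : ℕ) : ℝ) - ((i : ℕ) : ℝ)))⁻¹) ^ 2 *
      (Matrix.of fun i j : Fin (M + 1) => zwAmplitude (z + k) (w - k + 1) M (l.particle k i) *
        (l.particle k i : ℝ) ^ (j : ℕ)).det ^ 2 := by
  have h := Matrix.det_mul_column
    (fun i => zwAmplitude (z + k) (w - k + 1) M (l.particle k i))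
    (Matrix.vandermonde fun i => (l.particle k i : ℝ))
  simp only [Matrix.vandermonde_apply] at h
  rw [h, mul_pow, zwWeight, dim_eq_det_vandermonde k, ← Finset.prod_pow, mul_left_comm]
  congr 2
  refine Finset.prod_congr rfl fun i _ => ?_
  rw [zwAmplitude]
  congr 5
  · simp only [particle]
    push_cast
    ring
  · simp only [particle]
    push_cast
    ring

theorem zwWeight_nonneg {N : ℕ} (z w : ℂ) (l : GTSignature N) : 0 ≤ l.zwWeight z w := by
  rw [zwWeight]
  positivity

/-- Markov's inequality for the exponential moment, in unnormalized form: each signature in `T` has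
weight multiplied by at least `2 ^ D` in the doubled Gram determinant. -/
theorem exists_sum_zwWeight_le {z w : ℂ} {k : ℤ} (hz : -1 < (z + k).re) (hz0 : (z + k).re ≤ 0)
    (hw : 0 ≤ (w - k + 1).re) :
    ∃ A B : ℝ, 0 < A ∧ 0 < B ∧ ∀ (M D : ℕ) (T : Finset (GTSignature (M + 1))),
      (∀ l ∈ T, D ≤ (Finset.univ.filter fun i => 0 ≤ l.particle k i).card) →
      Summable (fun l : GTSignature (M + 1) => l.zwWeight z w) →
      2 ^ D * ∑ l ∈ T, l.zwWeight z w ≤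
        Real.exp (A + B * Real.log ((M : ℝ) + 1)) * zwNormalization z w (M + 1) := by
  classical
  obtain ⟨A, B, hA, hB, hdet⟩ := exists_det_gram_doubled_le hz hz0 hw
  refine ⟨A, B, hA, hB, fun M D T hT hsum => ?_⟩
  -- A finite window containing the interpolation nodes and every particle of every signature in
  -- `T`.
  set S : Finset ℤ := (Finset.univ.image fun a : Fin M => -(((a : ℕ) : ℤ) + 1)) ∪
    T.biUnion fun l => Finset.univ.image (l.particle k) with hS
  have hnode : ∀ a : Fin M, -(((a : ℕ) : ℤ) + 1) ∈ S := fun a =>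
    Finset.mem_union_left _ (Finset.mem_image_of_mem _ (Finset.mem_univ _))
  set Λ := (finite_particle_mem (N := M + 1) k S).toFinset with hΛ
  have hTΛ : T ⊆ Λ := fun l hl => by
    simp only [hΛ, Set.Finite.mem_toFinset, Set.mem_ofPred_eq]
    exact fun i => Finset.mem_union_right _ (Finset.mem_biUnion.2
      ⟨l, hl, Finset.mem_image_of_mem _ (Finset.mem_univ _)⟩)
  set φ : ℤ → ℝ := zwAmplitude (z + k) (w - k + 1) M with hφ
  set κ : ℝ :=
    ((∏ i : Fin (M + 1), ∏ j ∈ Finset.Ioi i, (((j : ℕ) : ℝ) - ((i : ℕ) : ℝ)))⁻¹) ^ 2 with hκ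
  have hκ0 : 0 ≤ κ := sq_nonneg _
  -- both Gram determinants as sums over signatures
  have hgram : ∀ u : ℤ → ℝ, (Matrix.of fun i j : Fin (M + 1) => ∑ x : S, u x *
      (φ x * ((x : ℤ) : ℝ) ^ (i : ℕ)) * (φ x * ((x : ℤ) : ℝ) ^ (j : ℕ))).det * κ =
      ∑ l ∈ Λ, (∏ i, u (l.particle k i)) * l.zwWeight z w := by
    intro u
    have h1 := Matrix.sum_prod_mul_det_sq (fun x : S => u x)
      (fun (j : Fin (M + 1)) (x : S) => φ x * ((x : ℤ) : ℝ) ^ (j : ℕ))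
    have h2 := sum_tuples_eq k S (fun x => (∏ i, u (x i)) *
      (Matrix.of fun i j : Fin (M + 1) => φ (x i) * ((x i : ℤ) : ℝ) ^ (j : ℕ)).det ^ 2) (by
        intro x σ
        have h3 : ∏ i, u ((x ∘ σ) i) = ∏ i, u (x i) := Equiv.prod_comp σ fun i => u (x i)
        have h4 := Matrix.det_permute σ
          (Matrix.of fun i j : Fin (M + 1) => φ (x i) * ((x i : ℤ) : ℝ) ^ (j : ℕ))
        have h5 : (Matrix.of fun i j : Fin (M + 1) => φ (x i) *
            ((x i : ℤ) : ℝ) ^ (j : ℕ)).submatrix σ id = Matrix.of fun i j : Fin (M + 1) =>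
              φ ((x ∘ σ) i) * (((x ∘ σ) i : ℤ) : ℝ) ^ (j : ℕ) := rfl
        rw [h3, ← h5, h4, mul_pow, ← Int.cast_pow, ← Units.val_pow_eq_pow_val, Int.units_sq]
        simp) (by
        intro x hx
        simp only [Function.Injective, not_forall] at hx
        obtain ⟨i, j, hij, hne⟩ := hx
        rw [Matrix.det_zero_of_row_eq hne]
        · simp
        · funext m
          simp [hij])
    rw [h1] at h2
    have h6 := mul_left_cancel₀ (by positivity) h2
    rw [h6, Finset.sum_mul]
    refine Finset.sum_congr rfl fun l _ => ?_
    rw [zwWeight_eq_det z w k l]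
    ring
  have h2 := hgram fun x => if 0 ≤ x then 2 else 1
  have h1 := hgram fun _ => 1
  have hle := mul_le_mul_of_nonneg_right (hdet M S hnode) hκ0
  rw [h2, mul_assoc, h1] at hle
  simp only [Finset.prod_const_one, one_mul] at hle
  have hupper : ∑ l ∈ Λ, l.zwWeight z w ≤ zwNormalization z w (M + 1) :=
    hsum.sum_le_tsum Λ fun l _ => l.zwWeight_nonneg z w
  calc 2 ^ D * ∑ l ∈ T, l.zwWeight z w
      ≤ ∑ l ∈ T, (∏ i, if 0 ≤ l.particle k i then (2 : ℝ) else 1) * l.zwWeight z w := by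
        rw [Finset.mul_sum]
        refine Finset.sum_le_sum fun l hl => ?_
        refine mul_le_mul_of_nonneg_right ?_ (l.zwWeight_nonneg z w)
        rw [Finset.prod_ite, Finset.prod_const, Finset.prod_const_one, mul_one]
        exact pow_le_pow_right₀ (by norm_num) (hT l hl)
    _ ≤ ∑ l ∈ Λ, (∏ i, if 0 ≤ l.particle k i then (2 : ℝ) else 1) * l.zwWeight z w :=
        Finset.sum_le_sum_of_subset_of_nonneg hTΛ fun l _ _ => mul_nonneg
          (Finset.prod_nonneg fun i _ => by split_ifs <;> norm_num) (l.zwWeight_nonneg z w)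
    _ ≤ _ := hle
    _ ≤ _ := by gcongr

end GTSignature

/-! ### The branching rule for dimensions. -/

theorem sum_Ico_descPochhammer (j : ℕ) {a b : ℤ} (hab : a ≤ b) :
    ((j : ℝ) + 1) * ∑ t ∈ Finset.Ico a b, (descPochhammer ℝ j).eval (t : ℝ) =
      (descPochhammer ℝ (j + 1)).eval (b : ℝ) - (descPochhammer ℝ (j + 1)).eval (a : ℝ) := by
  induction b, hab using Int.leInduction with
  | base => simp
  | succ b hab ih =>
    have h1 : Finset.Ico a (b + 1) = insert b (Finset.Ico a b) := by
      ext t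
      simp only [Finset.mem_Ico, Finset.mem_insert]
      omega
    have h2 : (descPochhammer ℝ (j + 1)).eval ((b : ℝ) + 1) =
        ((b : ℝ) + 1) * (descPochhammer ℝ j).eval (b : ℝ) := by
      rw [descPochhammer_succ_left]
      simp
    rw [h1, Finset.sum_insert (by simp), mul_add, ih]
    push_cast
    rw [h2, descPochhammer_succ_eval j (b : ℝ)]
    ring

theorem Matrix.det_vandermonde_eq_det_descPochhammer {N : ℕ} (v : Fin N → ℝ) :
    (Matrix.vandermonde v).det =
      (Matrix.of fun i j : Fin N => (descPochhammer ℝ (j : ℕ)).eval (v i)).det :=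
  Matrix.det_eval_matrixOfPolynomials_eq_det_vandermonde v (fun j => descPochhammer ℝ j)
    (fun j => descPochhammer_natDegree ℝ j) fun j => monic_descPochhammer ℝ j

/-- Summing a Vandermonde determinant over interlacing integer points. -/
theorem Matrix.sum_det_vandermonde_interlacing {N : ℕ} {v : Fin (N + 1) → ℤ} (hv : Monotone v) :
    (N.factorial : ℝ) * ∑ u ∈ Fintype.piFinset fun i : Fin N => Finset.Ico (v i.castSucc) (v i.succ),
      (Matrix.vandermonde fun i => (u i : ℝ)).det = (Matrix.vandermonde fun i => (v i : ℝ)).det := by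
  have h1 : (Matrix.vandermonde fun i => (v i : ℝ)).det = (Matrix.of fun i j : Fin N =>
      (descPochhammer ℝ ((j : ℕ) + 1)).eval (v i.succ : ℝ) -
        (descPochhammer ℝ ((j : ℕ) + 1)).eval (v i.castSucc : ℝ)).det := by
    rw [Matrix.det_vandermonde_eq_det_descPochhammer]
    -- Differences of consecutive rows: the constant first column becomes a unit vector, and the
    -- remaining minor consists of sums of falling factorials over the interlacing intervals.
    let B : Matrix (Fin (N + 1)) (Fin (N + 1)) ℝ := Matrix.of fun i j =>
      Fin.cases (motive := fun _ => ℝ) ((descPochhammer ℝ (j : ℕ)).eval (v 0 : ℝ))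
        (fun i => (descPochhammer ℝ (j : ℕ)).eval (v i.succ : ℝ) -
          (descPochhammer ℝ (j : ℕ)).eval (v i.castSucc : ℝ)) i
    have hB := Matrix.det_eq_of_forall_row_eq_smul_add_pred (B := B)
      (A := Matrix.of fun i j : Fin (N + 1) => (descPochhammer ℝ (j : ℕ)).eval (v i : ℝ))
      (fun _ => 1) (fun j => rfl) (fun i j => by simp [B])
    rw [hB, Matrix.det_succ_column_zero, Fin.sum_univ_succ,
      Finset.sum_eq_zero fun i _ => by simp [B]]
    simp only [B, Fin.val_zero, pow_zero, Matrix.of_apply, Fin.cases_zero, descPochhammer_zero,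
      Polynomial.eval_one, one_mul, add_zero]
    congr 1
  rw [h1]
  have h2 := MultilinearMap.map_sum_finset
    (Matrix.detRowAlternating (n := Fin N) (R := ℝ)).toMultilinearMap
    (fun (_ : Fin N) (t : ℤ) (j : Fin N) => (descPochhammer ℝ (j : ℕ)).eval (t : ℝ))
    (fun i : Fin N => Finset.Ico (v i.castSucc) (v i.succ))
  have h3 : ∑ u ∈ Fintype.piFinset fun i : Fin N => Finset.Ico (v i.castSucc) (v i.succ),
      (Matrix.vandermonde fun i => (u i : ℝ)).det =
      (Matrix.of fun i j : Fin N => ∑ t ∈ Finset.Ico (v i.castSucc) (v i.succ),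
        (descPochhammer ℝ (j : ℕ)).eval (t : ℝ)).det := by
    simp_rw [Matrix.det_vandermonde_eq_det_descPochhammer]
    refine h2.symm.trans ?_
    change Matrix.det _ = _
    congr 1
    ext i j
    simp
  have h4 := Matrix.det_mul_row (fun j : Fin N => ((j : ℕ) : ℝ) + 1)
    (Matrix.of fun i j : Fin N => ∑ t ∈ Finset.Ico (v i.castSucc) (v i.succ),
        (descPochhammer ℝ (j : ℕ)).eval (t : ℝ))
  have h5 : ∏ j : Fin N, (((j : ℕ) : ℝ) + 1) = N.factorial := by
    rw [Fin.prod_univ_eq_prod_range (fun j : ℕ => (j : ℝ) + 1) N,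
      ← Finset.prod_range_add_one_eq_factorial]
    push_cast
    rfl
  rw [h3, ← h5, ← h4]
  congr 1
  ext i j
  simp only [Matrix.of_apply]
  exact sum_Ico_descPochhammer j (hv (Fin.castSucc_lt_succ).le)

namespace GTSignature

theorem dim_pos {N : ℕ} (l : GTSignature N) : 0 < l.dim := by
  refine Finset.prod_pos fun i _ => Finset.prod_pos fun j hj => ?_
  rw [Finset.mem_Ioi] at hj
  have h1 : ((i : ℕ) : ℝ) < ((j : ℕ) : ℝ) := by exact_mod_cast hj
  have h2 : (l.row j : ℝ) ≤ l.row i := by exact_mod_cast l.antitone_row hj.le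
  exact div_pos (by linarith) (by linarith)

theorem dim_mul_superFactorial {n : ℕ} (l : GTSignature (n + 1)) :
    l.dim * n.superFactorial =
      (Matrix.vandermonde fun i => ((((i : ℕ) : ℤ) - l.row i : ℤ) : ℝ)).det := by
  rw [← Matrix.det_vandermonde_id_eq_superFactorial, Matrix.det_vandermonde, Matrix.det_vandermonde,
    dim, ← Finset.prod_mul_distrib]
  refine Finset.prod_congr rfl fun i _ => ?_
  rw [← Finset.prod_mul_distrib]
  refine Finset.prod_congr rfl fun j hj => ?_
  rw [Finset.mem_Ioi] at hj
  have h1 : ((i : ℕ) : ℝ) < ((j : ℕ) : ℝ) := by exact_mod_cast hj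
  rw [div_mul_cancel₀ _ (by linarith)]
  push_cast
  ring

theorem finite_interlaces {N : ℕ} (m : GTSignature (N + 1)) :
    {l : GTSignature N | l.Interlaces m}.Finite := by
  have hinj : Function.Injective (fun l : GTSignature N => l.row) := fun l m h => GTSignature.ext h
  refine ((Set.finite_Icc (fun i : Fin N => m.row i.succ)
    fun i : Fin N => m.row i.castSucc).preimage hinj.injOn).subset ?_
  intro l hl
  exact ⟨fun i => (hl i).2, fun i => (hl i).1⟩

/-- The branching rule: `Dim_{N+1}(μ)` is the sum of `Dim_N(λ)` over `λ ≺ μ`. -/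
theorem sum_dim_interlaces {n : ℕ} (m : GTSignature (n + 1 + 1)) :
    ∑ l ∈ m.finite_interlaces.toFinset, l.dim = m.dim := by
  have hv : Monotone fun i : Fin (n + 1 + 1) => ((i : ℕ) : ℤ) - m.row i := by
    intro i j hij
    have h1 := m.antitone_row hij
    have h2 : ((i : ℕ) : ℤ) ≤ ((j : ℕ) : ℤ) := by exact_mod_cast hij
    dsimp only
    omega
  have h1 := Matrix.sum_det_vandermonde_interlacing hv
  rw [← dim_mul_superFactorial] at h1
  have h2 : ∑ l ∈ m.finite_interlaces.toFinset, l.dim * n.superFactorial =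
      ∑ u ∈ Fintype.piFinset fun i : Fin (n + 1) => Finset.Ico
        (((i.castSucc : Fin (n + 2)) : ℕ) - m.row i.castSucc : ℤ)
        (((i.succ : Fin (n + 2)) : ℕ) - m.row i.succ : ℤ),
      (Matrix.vandermonde fun i => (u i : ℝ)).det := by
    -- In the coordinates `i - λ_i` the weak interlacing inequalities become membership in disjoint
    -- half-open intervals.
    refine Finset.sum_bij (fun l _ i => ((i : ℕ) : ℤ) - l.row i) ?_ ?_ ?_ ?_
    · intro l hl
      rw [Set.Finite.mem_toFinset] at hl
      rw [Fintype.mem_piFinset]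
      intro i
      have := hl i
      simp only [Finset.mem_Ico, Fin.val_succ, Fin.val_castSucc]
      push_cast
      omega
    · intro l _ l' _ h
      ext i
      have := congrFun h i
      omega
    · intro u hu
      rw [Fintype.mem_piFinset] at hu
      have hu' : ∀ i : Fin (n + 1), m.row i.succ ≤ ((i : ℕ) : ℤ) - u i ∧
          ((i : ℕ) : ℤ) - u i ≤ m.row i.castSucc := by
        intro i
        have := hu i
        simp only [Finset.mem_Ico, Fin.val_succ, Fin.val_castSucc] at this
        push_cast at this
        omega
      refine ⟨⟨fun i => ((i : ℕ) : ℤ) - u i, ?_⟩, ?_, ?_⟩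
      · rw [Fin.antitone_iff_succ_le]
        intro i
        exact (hu' i.succ).2.trans (hu' i.castSucc).1
      · rw [Set.Finite.mem_toFinset]
        exact fun i => ⟨(hu' i).2, (hu' i).1⟩
      · funext i
        simp
    · intro l _
      exact l.dim_mul_superFactorial
  rw [← h2, ← Finset.sum_mul, Nat.superFactorial_succ] at h1
  push_cast at h1
  have hs : (n.superFactorial : ℝ) ≠ 0 := by
    have h3 := dim_mul_superFactorial (⟨fun _ => 0, fun _ _ _ => le_rfl⟩ : GTSignature (n + 1))
    intro h0
    rw [h0, mul_zero, eq_comm, Matrix.det_vandermonde_eq_zero_iff] at h3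
    obtain ⟨i, j, hij, hne⟩ := h3
    apply hne
    ext
    simpa using hij
  have hf : ((n + 1).factorial : ℝ) ≠ 0 := by positivity
  have h4 : ((n + 1).factorial : ℝ) * n.superFactorial * (∑ l ∈ m.finite_interlaces.toFinset, l.dim) =
      (n + 1).factorial * n.superFactorial * m.dim := by linear_combination h1
  exact mul_left_cancel₀ (mul_ne_zero hf hs) h4

theorem dim_one (l : GTSignature 1) : l.dim = 1 := by
  rw [dim]
  refine Finset.prod_eq_one fun i _ => Finset.prod_eq_one fun j hj => ?_
  rw [Finset.mem_Ioi] at hj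
  omega

/-! ### The diagonal as a particle count. -/

theorem diagonalLength_positiveDiagram_le {N : ℕ} (k : ℤ) (l : GTSignature N) :
    l.positiveDiagram.diagonalLength ≤
      (Finset.univ.filter fun i => 0 ≤ l.particle k i).card + k.natAbs := by
  classical
  have h1 : l.positiveDiagram.diagonalLength ≤
      (Finset.univ.filter fun i : Fin N => ((i : ℕ) : ℤ) < l.row i).card := by
    refine (Finset.card_le_card ?_).trans (Finset.card_image_le (f := fun i : Fin N =>
      ((i : ℕ), (i : ℕ))))
    rintro ⟨i, j⟩ hij
    rw [Finset.mem_filter] at hij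
    obtain ⟨hmem, heq⟩ := hij
    obtain rfl : i = j := heq
    obtain ⟨h, hlt⟩ := (mem_positiveCells l i i).1 hmem
    exact Finset.mem_image.2 ⟨⟨i, h⟩, by simpa using hlt, rfl⟩
  refine h1.trans ?_
  rw [← Finset.card_filter_add_card_filter_not (s := Finset.univ.filter fun i : Fin N =>
    ((i : ℕ) : ℤ) < l.row i) (fun i => 0 ≤ l.particle k i)]
  refine add_le_add (Finset.card_le_card ?_) ?_
  · intro i hi
    simp only [Finset.mem_filter, Finset.mem_univ, true_and] at hi ⊢
    exact hi.2
  -- Indices lost by the shift have unshifted particles in `[0, -k)`, and distinct indices have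
  -- distinct particles.
  · have : (Finset.range k.natAbs).card = k.natAbs := Finset.card_range _
    rw [← this]
    refine Finset.card_le_card_of_injOn (fun i => (l.particle 0 i).toNat) ?_ ?_
    · intro i hi
      obtain ⟨h2, h3⟩ := Finset.mem_filter.1 (Finset.mem_coe.1 hi)
      have h4 := (Finset.mem_filter.1 h2).2
      simp only [particle] at h3
      simp only [Finset.coe_range, Set.mem_Iio, particle]
      omega
    · intro i hi j hj hij
      simp only [Finset.mem_coe, Finset.mem_filter, Finset.mem_univ, true_and] at hi hj
      apply (l.strictAnti_particle 0).injective
      have hi0 : 0 ≤ l.particle 0 i := by simp only [particle]; omega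
      have hj0 : 0 ≤ l.particle 0 j := by simp only [particle]; omega
      dsimp only at hij
      omega

instance (N : ℕ) : Countable (GTSignature N) :=
  (particle_injective (N := N) 0).countable

end GTSignature

/-! ### The law of a single level. -/

theorem zwLevel_nonneg (z w : ℂ) {N : ℕ} (l : GTSignature N) : 0 ≤ zwLevel z w l :=
  mul_nonneg (inv_nonneg.2 (tsum_nonneg fun l => l.zwWeight_nonneg z w)) (l.zwWeight_nonneg z w)

namespace IsZWMeasure
open MeasureTheory

variable {z w : ℂ} {ρ : Measure GTPath}

/-- The initial levels of a cylinder are forgotten one at a time: the event is covered by the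
possible vertices one level lower, and the branching rule adds up their dimensions. -/
theorem measure_tail_le (hρ : IsZWMeasure z w ρ) (n d : ℕ) (τ : GTPath) :
    ρ {t | ∀ m, n + 1 ≤ m → m ≤ n + 1 + d → t.sig m = τ.sig m} ≤
      ENNReal.ofReal ((τ.sig (n + 1)).dim *
        (zwLevel z w (τ.sig (n + 1 + d)) / (τ.sig (n + 1 + d)).dim)) := by
  induction n generalizing d τ with
  | zero =>
    rw [GTSignature.dim_one, one_mul]
    exact (hρ.measure_cylinder τ (0 + 1 + d) (by omega)).le
  | succ n ih =>
    classical
    set N := n + 1 + 1 + d with hN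
    set q : ℝ := zwLevel z w (τ.sig N) / (τ.sig N).dim with hq
    have hq0 : 0 ≤ q := div_nonneg (zwLevel_nonneg z w _) (τ.sig N).dim_pos.le
    set I := (τ.sig (n + 1 + 1)).finite_interlaces.toFinset with hI
    have hcover : {t : GTPath | ∀ m, n + 1 + 1 ≤ m → m ≤ N → t.sig m = τ.sig m} ⊆
        ⋃ l ∈ I, {t : GTPath | t.sig (n + 1) = l ∧
          ∀ m, n + 1 + 1 ≤ m → m ≤ N → t.sig m = τ.sig m} := by
      intro t ht
      simp only [Set.mem_iUnion]
      refine ⟨t.sig (n + 1), ?_, rfl, ht⟩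
      rw [hI, Set.Finite.mem_toFinset, Set.mem_ofPred_eq, ← ht (n + 1 + 1) le_rfl (by omega)]
      exact t.interlaces (n + 1)
    have hpiece : ∀ l : GTSignature (n + 1), ρ {t : GTPath | t.sig (n + 1) = l ∧
        ∀ m, n + 1 + 1 ≤ m → m ≤ N → t.sig m = τ.sig m} ≤ ENNReal.ofReal (l.dim * q) := by
      intro l
      rcases Set.eq_empty_or_nonempty {t : GTPath | t.sig (n + 1) = l ∧
        ∀ m, n + 1 + 1 ≤ m → m ≤ N → t.sig m = τ.sig m} with h | ⟨t₀, ht₀, ht₀'⟩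
      · rw [h, measure_empty]
        exact zero_le
      · have h1 := ih (d + 1) t₀
        have h2 : n + 1 + (d + 1) = N := by omega
        rw [h2, ht₀, ht₀' N (by omega) le_rfl] at h1
        refine (measure_mono ?_).trans h1
        rintro t ⟨ht, ht'⟩ m hm hmN
        rcases Nat.eq_or_lt_of_le hm with rfl | hlt
        · rw [ht, ht₀]
        · rw [ht' m hlt hmN, ht₀' m hlt hmN]
    calc _ ≤ ∑ l ∈ I, ENNReal.ofReal (l.dim * q) :=
          (measure_mono hcover).trans ((measure_biUnion_finset_le _ _).trans
            (Finset.sum_le_sum fun l _ => hpiece l))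
      _ = ENNReal.ofReal ((τ.sig (n + 1 + 1)).dim * q) := by
          rw [← ENNReal.ofReal_sum_of_nonneg fun l _ => mul_nonneg l.dim_pos.le hq0,
            ← Finset.sum_mul, GTSignature.sum_dim_interlaces]

/-- The distribution of `τ(N)` is dominated by `M_N^{z,w}`. -/
theorem measure_sig_eq_le (hρ : IsZWMeasure z w ρ) {n : ℕ} (l : GTSignature (n + 1)) :
    ρ {t | t.sig (n + 1) = l} ≤ ENNReal.ofReal (zwLevel z w l) := by
  rcases Set.eq_empty_or_nonempty {t : GTPath | t.sig (n + 1) = l} with h | ⟨τ, rfl⟩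
  · rw [h, measure_empty]
    exact zero_le
  · have h1 := hρ.measure_tail_le n 0 τ
    rw [add_zero, mul_div_cancel₀ _ (τ.sig (n + 1)).dim_pos.ne'] at h1
    refine (measure_mono ?_).trans h1
    intro t ht m hm hm'
    obtain rfl : m = n + 1 := le_antisymm hm' hm
    exact ht

theorem measure_le_of_forall_finset (hρ : IsZWMeasure z w ρ) {n : ℕ}
    (p : GTSignature (n + 1) → Prop) {b : ℝ}
    (hb : ∀ T : Finset (GTSignature (n + 1)), (∀ l ∈ T, p l) → ∑ l ∈ T, zwLevel z w l ≤ b) :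
    ρ {t | p (t.sig (n + 1))} ≤ ENNReal.ofReal b := by
  have hcover : {t : GTPath | p (t.sig (n + 1))} ⊆
      ⋃ l : {l : GTSignature (n + 1) // p l}, {t : GTPath | t.sig (n + 1) = l} := by
    intro t ht
    exact Set.mem_iUnion.2 ⟨⟨t.sig (n + 1), ht⟩, rfl⟩
  have hle : ρ {t | p (t.sig (n + 1))} ≤
      ∑' l : {l : GTSignature (n + 1) // p l}, ENNReal.ofReal (zwLevel z w l.1) :=
    (measure_mono hcover).trans ((measure_iUnion_le _).trans
      (ENNReal.tsum_le_tsum fun l => hρ.measure_sig_eq_le l.1))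
  refine hle.trans ?_
  rw [ENNReal.tsum_eq_iSup_sum]
  refine iSup_le fun T => ?_
  have h := hb (T.map (Function.Embedding.subtype p)) (fun l hl => by
    obtain ⟨x, _, rfl⟩ := Finset.mem_map.1 hl
    exact x.2)
  rw [Finset.sum_map] at h
  rw [← ENNReal.ofReal_sum_of_nonneg fun l _ => zwLevel_nonneg z w _]
  exact ENNReal.ofReal_le_ofReal h

end IsZWMeasure

/-! ### Tail bound and Borel–Cantelli. -/

theorem exists_measure_diagonal_le {z w : ℂ} (hzw : -(1 / 2 : ℝ) < (z + w).re) :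
    ∃ A B : ℝ, 0 < B ∧ ∀ ρ : MeasureTheory.Measure GTPath, IsZWMeasure z w ρ → ∀ n D : ℕ,
      ρ {τ | D ≤ τ.diagonal (n + 1)} ≤
        ENNReal.ofReal (Real.exp (A + B * Real.log ((n : ℝ) + 1)) / 2 ^ D) := by
  -- This shift brings the real part of `z + k` into `(-1, 0]`; the hypothesis on `z + w` then makes
  -- that of `w - k + 1` positive.
  set k : ℤ := -⌈z.re⌉ with hk
  have h1 := Int.ceil_lt_add_one z.re
  have h2 := Int.le_ceil z.re
  rw [Complex.add_re] at hzw
  obtain ⟨A, B, -, hB, hAB⟩ := GTSignature.exists_sum_zwWeight_le (z := z) (w := w) (k := k)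
    (by simp [hk]; linarith) (by simp [hk]; linarith) (by simp [hk]; linarith)
  refine ⟨A + k.natAbs * Real.log 2, B, hB, fun ρ hρ n D => ?_⟩
  refine hρ.measure_le_of_forall_finset (fun l => D ≤ l.positiveDiagram.diagonalLength)
    fun T hT => ?_
  simp only [zwLevel]
  rw [← Finset.mul_sum]
  by_cases hsum : Summable fun l : GTSignature (n + 1) => l.zwWeight z w
  · have h3 := hAB n (D - k.natAbs) T (fun l hl => by
      have := (hT l hl).trans (l.diagonalLength_positiveDiagram_le k)
      omega) hsum
    have hS : 0 ≤ zwNormalization z w (n + 1) := tsum_nonneg fun l => l.zwWeight_nonneg z w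
    have hsum0 : 0 ≤ ∑ l ∈ T, l.zwWeight z w := Finset.sum_nonneg fun l _ => l.zwWeight_nonneg z w
    have h4 : (2 : ℝ) ^ D ≤ 2 ^ (D - k.natAbs) * 2 ^ k.natAbs := by
      rw [← pow_add]
      exact pow_le_pow_right₀ (by norm_num) (by omega)
    have h5 : Real.exp (A + k.natAbs * Real.log 2 + B * Real.log ((n : ℝ) + 1)) =
        Real.exp (A + B * Real.log ((n : ℝ) + 1)) * 2 ^ k.natAbs := by
      rw [add_right_comm, Real.exp_add, ← Real.log_pow, Real.exp_log (by positivity)]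
    rw [h5, le_div_iff₀ (by positivity)]
    rcases hS.eq_or_lt with h0 | hpos
    · rw [← h0]
      simp
      positivity
    · rw [mul_assoc, inv_mul_le_iff₀ hpos]
      calc (∑ l ∈ T, l.zwWeight z w) * 2 ^ D
          ≤ (∑ l ∈ T, l.zwWeight z w) * (2 ^ (D - k.natAbs) * 2 ^ k.natAbs) := by gcongr
        _ = (2 ^ (D - k.natAbs) * ∑ l ∈ T, l.zwWeight z w) * 2 ^ k.natAbs := by ring
        _ ≤ (Real.exp (A + B * Real.log ((n : ℝ) + 1)) * zwNormalization z w (n + 1)) *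
            2 ^ k.natAbs := by gcongr
        _ = _ := by ring
  -- Without summability the normalization defaults to 0, and so do all level probabilities.
  · rw [zwNormalization, tsum_eq_zero_of_not_summable hsum, inv_zero, zero_mul]
    positivity

theorem theorem12 (z w : ℂ) (hzw : -(1 / 2 : ℝ) < (z + w).re) :
    ∃ c : ℝ, 0 < c ∧
      ∀ ρ : MeasureTheory.Measure GTPath, IsZWMeasure z w ρ →
        ∀ᵐ τ ∂ρ,
          Filter.limsup (fun N : ℕ => (((τ.diagonal N : ℝ) / Real.log (N : ℝ) : ℝ) : EReal))
            Filter.atTop ≤ (c : EReal) := by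
  obtain ⟨A, B, hB, hAB⟩ := exists_measure_diagonal_le hzw
  -- Since `log 2 > 1/2`, this threshold makes `2 ^ D` at least `(n + 1) ^ (B + 2)`, so the tail
  -- probabilities are `O((n + 1)⁻²)`.
  refine ⟨2 * (B + 2), by positivity, fun ρ hρ => ?_⟩
  set D : ℕ → ℕ := fun n => ⌈2 * (B + 2) * Real.log ((n : ℝ) + 1)⌉₊ with hD
  have hbound : ∀ n, ρ {τ | D n ≤ τ.diagonal (n + 1)} ≤
      ENNReal.ofReal (Real.exp A * (1 / ((n : ℝ) + 1) ^ 2)) := by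
    intro n
    refine (hAB ρ hρ n (D n)).trans (ENNReal.ofReal_le_ofReal ?_)
    have hpos : (0 : ℝ) < (n : ℝ) + 1 := by positivity
    have hlog : 0 ≤ Real.log ((n : ℝ) + 1) :=
      Real.log_nonneg (by linarith [(Nat.cast_nonneg n : (0 : ℝ) ≤ n)])
    have h1 : 2 * (B + 2) * Real.log ((n : ℝ) + 1) ≤ D n := Nat.le_ceil _
    have h2 : Real.exp ((B + 2) * Real.log ((n : ℝ) + 1)) ≤ 2 ^ D n := by
      rw [← Real.exp_log (by positivity : (0 : ℝ) < 2 ^ D n), Real.log_pow]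
      refine Real.exp_le_exp.2 ?_
      have hD0 : (0 : ℝ) ≤ D n := Nat.cast_nonneg _
      nlinarith [Real.log_two_gt_d9]
    have h3 : Real.exp (2 * Real.log ((n : ℝ) + 1)) = ((n : ℝ) + 1) ^ 2 := by
      have := Real.log_pow ((n : ℝ) + 1) 2
      push_cast at this
      rw [← this, Real.exp_log (by positivity)]
    calc Real.exp (A + B * Real.log ((n : ℝ) + 1)) / 2 ^ D n
        ≤ Real.exp (A + B * Real.log ((n : ℝ) + 1)) /
            Real.exp ((B + 2) * Real.log ((n : ℝ) + 1)) := by gcongr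
      _ = Real.exp A * (1 / ((n : ℝ) + 1) ^ 2) := by
        rw [← h3, ← Real.exp_sub, one_div, ← Real.exp_neg, ← Real.exp_add]
        congr 1
        ring
  have hsummable : Summable fun n : ℕ => Real.exp A * (1 / ((n : ℝ) + 1) ^ 2) := by
    refine Summable.mul_left _ ?_
    have := (summable_nat_add_iff 1).2 (Real.summable_one_div_nat_pow.2 one_lt_two)
    simpa using this
  have hfin : ∑' n, ρ {τ | D n ≤ τ.diagonal (n + 1)} ≠ ⊤ :=
    ne_top_of_le_ne_top hsummable.tsum_ofReal_ne_top (ENNReal.tsum_le_tsum hbound)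
  filter_upwards [MeasureTheory.ae_eventually_notMem hfin] with τ hτ
  refine Filter.limsup_le_of_le (by isBoundedDefault) ?_
  rw [Filter.eventually_atTop] at hτ ⊢
  obtain ⟨n₀, hn₀⟩ := hτ
  -- The additional 2 ensures `N ≥ 2`, so that `log N` is positive.
  refine ⟨n₀ + 2, fun N hN => ?_⟩
  obtain ⟨n, rfl⟩ : ∃ n, N = n + 1 := ⟨N - 1, by omega⟩
  have h1 := hn₀ n (by omega)
  simp only [not_le, hD] at h1
  have h2 := Nat.lt_ceil.1 h1
  have hn1 : (1 : ℝ) ≤ n := by exact_mod_cast (by omega : 1 ≤ n)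
  rw [EReal.coe_le_coe_iff, Nat.cast_succ, div_le_iff₀ (Real.log_pos (by linarith))]
  exact h2.le
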